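/- Let $q\equiv 1\pmod 4$ be a prime power and $\mathbb F_q\subset\mathbb F_{q^{10}}$. For an $\mathbb F_q$-subspace $U$ of $\mathbb F_{q^{10}}^2$ let $L_U=\{\langle u\rangle_{\mathbb F_{q^{10}}}: u\in U\setminus\{0\}\}$ be the $\mathbb F_q$-linear set of $\mathrm{PG}(1,q^{10})$ defined by $U$; its rank is $\dim_{\mathbb F_q}U$. For an $\mathbb F_q$-linear map $f$ of $\mathbb F_{q^{10}}$ put $U_f=\{(x,f(x)):x\in\mathbb F_{q^{10}}\}$ and $L_f=L_{U_f}$. A linear set $L$ is *maximum scattered* if it is defined by an $\mathbb F_q$-subspace of dimension $10$ and $|L|=(q^{10}-1)/(q-1)$. The *$\mathcal Z(\Gamma\mathrm L)$-class* of $L$ is the greatest integer $r$ such that there are $\mathbb F_q$-subspaces $U_1,\dots,U_r$ of $\mathbb F_{q^{10}}^2$ with $L_{U_i}=L$ for all $i$ and $U_i\neq\lambda U_j$ for all $\lambda\in\mathbb F_{q^{10}}^*$ and $i\neq j$. The linear set $L$ is *simple* if its *$\Gamma\mathrm L$-class* is one, where the $\Gamma\mathrm L$-class is the greatest integer $s$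 such that there are $\mathbb F_q$-subspaces $U_1,\dots,U_s$ of $\mathbb F_{q^{10}}^2$ with $L_{U_i}=L$ for all $i$ that lie on pairwise distinct $\Gamma\mathrm L(2,q^{10})$-orbits. Let $$\psi_{10}(x)=\tfrac12\left(x^{q}+x^{q^{4}}-x^{q^{6}}+x^{q^{9}}\right).$$ Then: 1. the $\mathcal Z(\Gamma\mathrm L)$-class of $L_{\psi_{10}}$ is two; 2. $L_{\psi_{10}}$ is simple; 3. $L_{\psi_{10}}$ is a maximum scattered $\mathbb F_q$-linear set of $\mathrm{PG}(1,q^{10})$, and it is new, that is, it is not $\mathrm{P\Gamma L}(2,q^{10})$-equivalent to any of the previously known ones in $\mathrm{PG}(1,q^{10})$, which are - those of pseudoregulus type, $L_f$ with $f(x)=x^{q^s}$, $1\le s\le 9$, $\gcd(s,10)=1$; - those of LP-type, $L_f$ with $f(x)=\delta x^{q^s}+x^{q^{10-s}}$, $1\le s\le 9$, $\gcd(s,10)=1$, $\delta\in\mathbb F_{q^{10}}$, $\mathrm N_{q^{10}/q}(\delta)\notin\{0,1\}$. -/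

import Mathlib

open scoped LinearAlgebra.Projectivization Pointwise

namespace LinSet

section Defs

variable (K : Type*) {L : Type*} [Field K] [Field L] [Algebra K L]

/-- The linear set `L_U` of the projective line `PG(1, L)` defined by a `K`-subspace `U` of `L²`:
the set of the points `⟨u⟩_L` with `u ∈ U` nonzero. -/
def linearSet {K : Type*} [Field K] [Algebra K L] (U : Submodule K (L × L)) : Set (ℙ L (L × L)) :=
  {P | ∃ (u : L × L) (hu : u ≠ 0), u ∈ U ∧ P = Projectivization.mk L u hu}

/-- Two subsets of `L²` lie on the same orbit of `ΓL(2, L)`, the group of the bijective maps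
`L² → L²` that are semilinear with respect to some automorphism `σ` of the field `L`. -/
def GammaLEquiv (A B : Set (L × L)) : Prop :=
  ∃ (σ : L ≃+* L) (g : (L × L) →ₛₗ[(σ : L →+* L)] (L × L)), Function.Bijective g ∧ g '' A = B

/-- Two sets of points of `PG(1, L)` are `PΓL(2, L)`-equivalent: a collineation that is induced
by an element of `ΓL(2, L)` maps the first one onto the second one. -/
def PGammaLEquiv (A B : Set (ℙ L (L × L))) : Prop :=
  ∃ (σ : L ≃+* L) (g : (L × L) →ₛₗ[(σ : L →+* L)] (L × L)) (hg : Function.Bijective g),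
    Projectivization.map g hg.injective '' A = B

/-- The set `S` of points is of `Z(ΓL)`-class `r` as a `K`-linear set: `r` is the greatest
integer for which there are `K`-subspaces `U₁, …, U_r` of `L²` that all define `S`, such that
`U_i ≠ c U_j` for all `c ∈ L*` and all `i ≠ j`. -/
def HasZClass (S : Set (ℙ L (L × L))) (r : ℕ) : Prop :=
  IsGreatest {m : ℕ | ∃ U : Fin m → Submodule K (L × L),
    (∀ i, linearSet (U i) = S) ∧ ∀ i j, i ≠ j → ∀ c : Lˣ, U i ≠ c • U j} r

/-- The set `S` of points is of `ΓL`-class `s` as a `K`-linear set: `s` is the greatest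
integer for which there are `K`-subspaces `U₁, …, U_s` of `L²` that all define `S` and that lie
on pairwise distinct `ΓL(2, L)`-orbits. -/
def HasGammaLClass (S : Set (ℙ L (L × L))) (s : ℕ) : Prop :=
  IsGreatest {m : ℕ | ∃ U : Fin m → Submodule K (L × L),
    (∀ i, linearSet (U i) = S) ∧
      ∀ i j, i ≠ j → ¬ GammaLEquiv (U i : Set (L × L)) (U j : Set (L × L))} s

/-- A `K`-linear set is simple if its `ΓL`-class is one. -/
def IsSimple (S : Set (ℙ L (L × L))) : Prop := HasGammaLClass K S 1

/-- `S` is a scattered `K`-linear set of rank `k`: it is defined by a `k`-dimensional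
`K`-subspace, and it has size `(q ^ k - 1) / (q - 1)`, `q = |K|`. -/
def IsScattered (S : Set (ℙ L (L × L))) (k : ℕ) : Prop :=
  (∃ U : Submodule K (L × L), Module.finrank K U = k ∧ linearSet U = S) ∧
    S.ncard = (Nat.card K ^ k - 1) / (Nat.card K - 1)

/-- A maximum scattered `K`-linear set of `PG(1, L)`: a scattered one of rank `n = [L : K]`. -/
def IsMaximumScattered (S : Set (ℙ L (L × L))) : Prop :=
  IsScattered K S (Module.finrank K L)

end Defs

section Families

variable (K L : Type*) [Field K] [Fintype K] [Field L] [Algebra K L]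

/-- The `K`-linear map `x ↦ x ^ (q ^ i)` of `L`, `q = |K|`. -/
noncomputable def frob (i : ℕ) : L →ₗ[K] L := (FiniteField.frobeniusAlgHom K L ^ i).toLinearMap

theorem frob_apply (i : ℕ) (x : L) : frob K L i x = x ^ (Fintype.card K ^ i) := by
  have h : ∀ j : ℕ, (FiniteField.frobeniusAlgHom K L ^ j) x = x ^ (Fintype.card K ^ j) := by
    intro j
    induction j with
    | zero => simp
    | succ j ih => rw [pow_succ', AlgHom.mul_apply, ih]; simp [pow_succ, pow_mul]
  simpa [frob] using h i

/-- `ψ_{2t}(x) = (x ^ q + x ^ (q ^ (t - 1)) - x ^ (q ^ (t + 1)) + x ^ (q ^ (2 t - 1))) / 2`, as a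
`K`-linear map of `L`. -/
noncomputable def psi (t : ℕ) : L →ₗ[K] L :=
  (2 : L)⁻¹ • (frob K L 1 + frob K L (t - 1) - frob K L (t + 1) + frob K L (2 * t - 1))

/-- A linear set of pseudoregulus type in normal form: `L_f` with `f(x) = x ^ (q ^ s)`, where
`1 ≤ s ≤ n - 1`, `gcd(s, n) = 1`, `n = [L : K]`. The subspace `U_f = {(x, f x)}` is `f.graph`. -/
def IsPseudoregulusForm (S : Set (ℙ L (L × L))) : Prop :=
  ∃ s : ℕ, 1 ≤ s ∧ s < Module.finrank K L ∧ s.Coprime (Module.finrank K L) ∧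
    S = linearSet (frob K L s).graph

/-- A linear set of LP-type in normal form: `L_f` with `f(x) = δ x ^ (q ^ s) + x ^ (q ^ (n - s))`,
where `1 ≤ s ≤ n - 1`, `gcd(s, n) = 1`, `n = [L : K]` and the norm of `δ` over `K` is not in
`{0, 1}`. -/
def IsLPForm (S : Set (ℙ L (L × L))) : Prop :=
  ∃ (s : ℕ) (δ : L), 1 ≤ s ∧ s < Module.finrank K L ∧ s.Coprime (Module.finrank K L) ∧
    Algebra.norm K δ ≠ 0 ∧ Algebra.norm K δ ≠ 1 ∧
    S = linearSet (δ • frob K L s + frob K L (Module.finrank K L - s)).graph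

end Families

end LinSet

/-! Write ψ for `psi K L 5` and ψ* for `psiAdj K L`. The point ⟨(1, m)⟩ lies on L_f exactly when m
is a value of f(x)/x, so linear sets of graphs are compared through `directions`.

Scatteredness. Split L into the eigenspaces of x ↦ x^(q^5). There ψ is x ↦ x^(q^4) on the +1 part
and x ↦ x^q on the -1 part. For two solutions of ψ(x) = m x, a 2×2 determinant in their components
vanishes, so the solutions are proportional, and the ratio is fixed by Frobenius
(`scatteredMap_psi`).

Classification. A subspace defining L_ψ is the graph of some g with the directions of ψ
(`eq_graph_of_linearSet_eq`). If m is a direction of g, then the Dickson matrix of g minus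
diag(m^(q^i)) is singular. As a polynomial in m its determinant has degree 1 + q + ... + q^9, the
number of directions, and its lower coefficients are, up to sign, the principal minors. The
polynomials for g and ψ have the same leading term and as many common zeros as their degree, hence
the same principal minors (`dickson_minor_eq`). Minors of size at most five fix the support of g and
certain cyclic products of its coefficients (`coeff_relations`). Hilbert 90 turns these into g(x) =
c⁻¹ψ(c x) or g(x) = c⁻¹ψ*(c x) (`exists_scaling`, `directions_eq_imp`).

Both graphs define the same linear set, because adjoint maps have equal directions, and neither is a
scalar multiple of the other: class two. But ψ* is also the inverse of ψ, so swapping coordinates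
exchanges the graphs: the linear set is simple.

Newness. An equivalence with L_f gives f(a y + b ψ(y)) = c y + d ψ(y) for all y, and comparing
coefficients of linearized polynomials forces a = b = c = d = 0. -/

namespace LinSet

/-! ### Powers of the q-Frobenius. -/

section Frobenius

variable (K : Type*) {L : Type*} [Field K] [Fintype K] [Field L] [Algebra K L]

/-- The `K`-algebra endomorphism `x ↦ x ^ (q ^ i)` of `L`, `q = |K|`. -/
noncomputable def fr (i : ℕ) : L →ₐ[K] L := FiniteField.frobeniusAlgHom K L ^ i

theorem frob_eq_fr (i : ℕ) (x : L) : frob K L i x = fr K i x := rfl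

theorem fr_apply (i : ℕ) (x : L) : fr K i x = x ^ (Fintype.card K ^ i) := frob_apply K L i x

@[simp] theorem fr_zero (x : L) : fr K 0 x = x := by simp [fr_apply]

theorem fr_fr (i j : ℕ) (x : L) : fr K i (fr K j x) = fr K (i + j) x := by
  simp only [fr_apply, ← pow_mul, ← pow_add, add_comm]

theorem fr_injective (i : ℕ) : Function.Injective (fr K i : L → L) := 
  RingHom.injective (fr K i : L →ₐ[K] L).toRingHom

variable [Finite L]

theorem fr_finrank (x : L) : fr K (Module.finrank K L) x = x := by
  have := Fintype.ofFinite L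
  rw [fr_apply, ← Module.card_eq_pow_finrank, FiniteField.pow_card]

theorem fr_mod {n : ℕ} (hn : Module.finrank K L = n) (i : ℕ) (x : L) :
    fr K (i % n) x = fr K i x := by
  have h : ∀ m : ℕ, ∀ y : L, fr K (n * m) y = y := by
    intro m
    induction m with
    | zero => simp
    | succ m ih =>
      intro y
      rw [mul_add, mul_one, ← fr_fr, ← hn, fr_finrank, hn, ih]
  conv_rhs => rw [← Nat.mod_add_div i n, ← fr_fr, h]

/-- The Galois group of L over K is generated by Frobenius, so a fixed element of it lies in K. -/
theorem fr_one_eq_self_iff (x : L) : fr K 1 x = x ↔ ∃ k : K, algebraMap K L k = x := by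
  have := Fintype.ofFinite L
  refine ⟨fun h => ?_, ?_⟩
  · have := FiniteField.bijective_frobeniusAlgEquivOfAlgebraic_pow K L
    have hfd : Module.Finite K L := Module.Finite.of_finite
    refine (IsGalois.mem_range_algebraMap_iff_fixed (F := K) x).2 fun g => ?_
    obtain ⟨m, rfl⟩ := this.2 g
    have hm : ∀ m : ℕ, (FiniteField.frobeniusAlgEquivOfAlgebraic K L ^ m) x = x := by
      intro m
      induction m with
      | zero => simp
      | succ m ih =>
        have h1 : FiniteField.frobeniusAlgEquivOfAlgebraic K L x = x := by
          simpa [FiniteField.coe_frobeniusAlgEquivOfAlgebraic, fr_apply] using h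
        rw [pow_succ, AlgEquiv.mul_apply, h1, ih]
    exact hm m
  · rintro ⟨k, rfl⟩
    exact (fr K 1).commutes k

end Frobenius

/-! ### Linear maps as linearized polynomials. -/

section LinPoly

variable (K : Type*) {L : Type*} [Field K] [Fintype K] [Field L] [Algebra K L] {n : ℕ}

/-- The `K`-linear map of `L` given by the linearized polynomial with coefficients `β`. -/
noncomputable def linPoly (β : Fin n → L) : L →ₗ[K] L := ∑ j, β j • frob K L j

theorem linPoly_apply (β : Fin n → L) (x : L) :
    linPoly K β x = ∑ j, β j * fr K (j : ℕ) x := by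
  simp [linPoly, frob_eq_fr]

variable [Finite L]

/-- Distinct algebra homomorphisms are linearly independent. This licenses every later comparison of
coefficients. -/
theorem linPoly_injective (hn : Module.finrank K L = n) :
    Function.Injective (linPoly K : (Fin n → L) → (L →ₗ[K] L)) := by
  subst hn
  have hli : LinearIndependent L fun j : Fin (Module.finrank K L) => frob K L j :=
    (linearIndependent_algHom_toLinearMap K L L).comp _
      (FiniteField.bijective_frobeniusAlgHom_pow K L).1
  intro β γ h
  have h' := Fintype.linearIndependent_iff.1 hli (β - γ) (by
    simpa [linPoly, sub_smul, sub_eq_zero] using h)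
  funext j
  exact sub_eq_zero.1 (h' j)

theorem linPoly_surjective (hn : Module.finrank K L = n) :
    Function.Surjective (linPoly K : (Fin n → L) → (L →ₗ[K] L)) := by
  have hfd : Module.Finite K L := Module.Finite.of_finite
  have : Finite (L →ₗ[K] L) := Finite.of_injective (fun f : L →ₗ[K] L => (f : L → L)) DFunLike.coe_injective
  refine ((Nat.bijective_iff_injective_and_card _).2 ⟨linPoly_injective K hn, ?_⟩).2
  have h1 : Nat.card (L →ₗ[K] L) = Nat.card K ^ (n * n) := by
    rw [Module.natCard_eq_pow_finrank (K := K), Module.finrank_linearMap, hn]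
  have h2 : Nat.card L = Nat.card K ^ n := by
    rw [Module.natCard_eq_pow_finrank (K := K), hn]
  rw [h1, Nat.card_fun, h2, Nat.card_fin, pow_mul]

end LinPoly

/-! ### Dickson matrices and their principal minors. -/

section Dickson

/-- The matrix `A` with the rows in `s` replaced by those of the identity matrix. -/
def unitRows {m R : Type*} [DecidableEq m] [CommRing R] (s : Finset m) (A : Matrix m m R) :
    Matrix m m R :=
  Matrix.of fun i j => if i ∈ s then (1 : Matrix m m R) i j else A i j

/-- Multilinearity in the rows: `s` records the rows in which the diagonal summand is chosen. -/
theorem det_sub_diagonal {m R : Type*} [Fintype m] [DecidableEq m] [CommRing R]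
    (A : Matrix m m R) (d : m → R) :
    (A - Matrix.diagonal d).det =
      ∑ s : Finset m, (∏ i ∈ s, -d i) * (unitRows s A).det := by
  let f := (Matrix.detRowAlternating (n := m) (R := R)).toMultilinearMap
  let a : m → m → R := fun i j => A i j
  let b : m → m → R := fun i j => (-d i) * (1 : Matrix m m R) i j
  have h : (A - Matrix.diagonal d).det = f (b + a) := by
    change _ = Matrix.det (Matrix.of (b + a))
    congr 1
    ext i j
    simp only [Matrix.sub_apply, Matrix.diagonal_apply, Matrix.of_apply, Pi.add_apply, a, b,
      Matrix.one_apply]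
    split_ifs <;> ring
  rw [h, MultilinearMap.map_add_univ]
  refine Finset.sum_congr rfl fun s _ => ?_
  have := f.map_piecewise_smul (fun i => -d i) (fun i j => unitRows s A i j) s
  rw [smul_eq_mul] at this
  refine Eq.trans ?_ this
  congr 1
  ext i j
  by_cases hi : i ∈ s <;> simp [hi, a, b, unitRows]

theorem det_unitRows {m R k : Type*} [Fintype m] [DecidableEq m] [CommRing R]
    [Fintype k] [DecidableEq k] (A : Matrix m m R) (e : k → m) (he : Function.Injective e)
    (s : Finset m) (hs : ∀ i, i ∉ s ↔ i ∈ Set.range e) :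
    (unitRows s A).det = (A.submatrix e e).det := by
  rw [Matrix.twoBlockTriangular_det (unitRows s A) (fun i => i ∉ s)]
  · have h2 : Matrix.toSquareBlockProp (unitRows s A) (fun i => ¬ (i ∉ s)) = 1 := by
      ext i j
      have hi : (i : m) ∈ s := not_not.1 i.2
      simp [Matrix.toSquareBlockProp_def, unitRows, hi, Matrix.one_apply, Subtype.ext_iff]
    rw [h2, Matrix.det_one, mul_one]
    let f : k ≃ {i // i ∉ s} :=
      (Equiv.ofInjective e he).trans (Equiv.subtypeEquivRight fun i => (hs i).symm)
    have hf : ∀ i, ((f i : {i // i ∉ s}) : m) = e i := fun i => rfl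
    rw [← Matrix.det_submatrix_equiv_self f]
    congr 1
    ext i j
    have hi : e i ∉ s := (hs _).2 ⟨i, rfl⟩
    simp [Matrix.toSquareBlockProp_def, hf, unitRows, hi]
  · intro i hi j hj
    have hi' : i ∈ s := not_not.1 hi
    have : i ≠ j := fun h => hj (h ▸ hi')
    simp [hi', unitRows, Matrix.one_apply, this]

variable (K : Type*) {L : Type*} [Field K] [Fintype K] [Field L] [Algebra K L] {n : ℕ}

/-- The Dickson matrix of a linearized polynomial. -/
noncomputable def dickson (β : Fin n → L) : Matrix (Fin n) (Fin n) L :=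
  fun i j => fr K (i : ℕ) (β (j - i))

variable [Finite L]

theorem dickson_sum [NeZero n] (hn : Module.finrank K L = n) (β : Fin n → L) (x : L) (i : Fin n) :
    ∑ j, dickson K β i j * fr K (j : ℕ) x = fr K (i : ℕ) (linPoly K β x) := by
  rw [linPoly_apply, map_sum, ← Equiv.sum_comp (Equiv.addRight i)]
  refine Finset.sum_congr rfl fun j _ => ?_
  rw [map_mul, fr_fr]
  simp only [dickson, Equiv.coe_addRight, add_sub_cancel_right, Fin.val_add]
  rw [fr_mod K hn, add_comm]

/-- Row i is the q^i-th power of the equation f(x) = m x, so the vector of conjugates of x lies in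
the kernel. -/
theorem det_dickson_sub [NeZero n] (hn : Module.finrank K L = n) (β : Fin n → L) {m x : L}
    (hx : x ≠ 0) (h : linPoly K β x = m * x) :
    (dickson K β - Matrix.diagonal fun i : Fin n => fr K (i : ℕ) m).det = 0 := by
  refine Matrix.exists_mulVec_eq_zero_iff.1 ⟨fun j : Fin n => fr K (j : ℕ) x, ?_, ?_⟩
  · intro h0
    have := congrFun h0 0
    simp [hx] at this
  · funext i
    rw [Matrix.sub_mulVec, Pi.sub_apply, Matrix.mulVec_diagonal]
    simp only [Matrix.mulVec, dotProduct, Pi.zero_apply]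
    rw [dickson_sum K hn, h, map_mul, sub_self]

omit [Finite L] in
open Polynomial in
-- The sum is a polynomial in m. Its exponents, sums of distinct powers of q, differ for different
-- `s`, so no coefficients merge. Since `hc` kills the top term, the degree is below the number of
-- zeros.
theorem sum_prod_fr_eq_zero (c : Finset (Fin n) → L) (hc : c Finset.univ = 0) (S : Finset L)
    (hS : ∑ i : Fin n, Fintype.card K ^ (i : ℕ) ≤ S.card)
    (h : ∀ m ∈ S, ∑ s : Finset (Fin n), c s * ∏ i ∈ s, fr K (i : ℕ) m = 0) : c = 0 := by
  have hq : 2 ≤ Fintype.card K := Fintype.one_lt_card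
  let ex : Finset (Fin n) → ℕ := fun s => ∑ i ∈ s, Fintype.card K ^ (i : ℕ)
  have hex : Function.Injective ex := by
    intro s t hst
    apply Finset.map_injective Fin.valEmbedding
    apply Finset.geomSum_injective hq
    simpa [ex] using hst
  let P : L[X] := ∑ s : Finset (Fin n), C (c s) * X ^ ex s
  have hcoeff : ∀ s, P.coeff (ex s) = c s := by
    intro s
    simp only [P, finsetSum_coeff, coeff_C_mul, coeff_X_pow]
    rw [Finset.sum_eq_single s]
    · simp
    · intro t _ hts
      rw [if_neg fun h => hts (hex h).symm, mul_zero]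
    · simp
  have hP : P = 0 := by
    by_contra hP0
    have hdeg : P.degree < S.card := by
      refine (degree_sum_le _ _).trans_lt ?_
      rw [Finset.sup_lt_iff (WithBot.bot_lt_coe _)]
      intro s _
      by_cases hs : s = Finset.univ
      · rw [hs, hc]; simp
      · refine (degree_C_mul_X_pow_le _ _).trans_lt ?_
        have hlt : ex s < ex Finset.univ :=
          lt_of_le_of_ne (Finset.sum_le_sum_of_subset (Finset.subset_univ s))
            fun h => hs (hex h)
        exact_mod_cast hlt.trans_le hS
    refine hP0 (eq_zero_of_degree_lt_of_eval_finset_eq_zero S hdeg fun m hm => ?_)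
    rw [← h m hm]
    simp only [P, eval_finsetSum, eval_mul, eval_C, eval_pow, eval_X, ex]
    refine Finset.sum_congr rfl fun s _ => ?_
    rw [← Finset.prod_pow_eq_pow_sum]
    simp only [fr_apply]
  funext s
  rw [← hcoeff, hP]; simp

/-- If the nonzero values of `x ↦ f(x) / x` are the same for two linearized polynomials, and as
many as possible, then their Dickson matrices have the same principal minors. -/
theorem dickson_minor_eq [NeZero n] (hn : Module.finrank K L = n) (β γ : Fin n → L)
    (S : Finset L) (hS : ∑ i : Fin n, Fintype.card K ^ (i : ℕ) ≤ S.card)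
    (hβ : ∀ m ∈ S, ∃ x, x ≠ 0 ∧ linPoly K β x = m * x)
    (hγ : ∀ m ∈ S, ∃ x, x ≠ 0 ∧ linPoly K γ x = m * x)
    {k : ℕ} (e : Fin k → Fin n) (he : Function.Injective e) :
    ((dickson K β).submatrix e e).det = ((dickson K γ).submatrix e e).det := by
  classical
  let D : (Fin n → L) → Finset (Fin n) → L := fun β s =>
    (unitRows s (dickson K β)).det
  have key := sum_prod_fr_eq_zero K (fun s => (-1) ^ s.card * (D β s - D γ s))
    (by simp [D, unitRows]) S hS (by
      intro m hm
      obtain ⟨x, hx, hx'⟩ := hβ m hm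
      obtain ⟨y, hy, hy'⟩ := hγ m hm
      have h1 := det_dickson_sub K hn β hx hx'
      have h2 := det_dickson_sub K hn γ hy hy'
      rw [det_sub_diagonal] at h1 h2
      rw [← sub_self (0 : L)]
      nth_rewrite 1 [← h1]
      rw [← h2, ← Finset.sum_sub_distrib]
      refine Finset.sum_congr rfl fun s _ => ?_
      rw [Finset.prod_neg]
      simp only [D]
      ring)
  let s : Finset (Fin n) := Finset.univ.filter fun i => i ∉ Set.range e
  have hs : ∀ i, i ∉ s ↔ i ∈ Set.range e := by intro i; simp [s]
  have := congrFun key s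
  simp only [Pi.zero_apply, mul_eq_zero, pow_eq_zero_iff', neg_eq_zero, one_ne_zero, false_and,
    false_or, D, sub_eq_zero] at this
  rwa [det_unitRows _ e he s hs, det_unitRows _ e he s hs] at this

end Dickson

open Classical in
theorem card_units_smul {K V : Type*} [Field K] [Fintype K] [AddCommGroup V] [Module K V]
    {v : V} (hv : v ≠ 0) :
    (Finset.univ.image fun k : Kˣ => (k : K) • v).card = Fintype.card K - 1 := by
  rw [Finset.card_image_of_injective, Finset.card_univ, Fintype.card_units]
  intro k l h
  exact Units.ext (smul_left_injective K hv h)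

/-! ### Linear sets of graphs, and counting their points. -/

section Directions

variable {K L : Type*} [Field K] [Field L] [Algebra K L]

/-- The values of `x ↦ f(x) / x`, `x ≠ 0`. -/
def directions (f : L →ₗ[K] L) : Set L := {m | ∃ x, x ≠ 0 ∧ f x = m * x}

theorem one_prod_ne_zero (m : L) : ((1, m) : L × L) ≠ 0 := by simp

/-- The point of the projective line with coordinates `(1, m)`. -/
def affinePoint (m : L) : ℙ L (L × L) := Projectivization.mk L (1, m) (one_prod_ne_zero m)

theorem affinePoint_injective : Function.Injective (affinePoint : L → ℙ L (L × L)) := by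
  intro m m' h
  obtain ⟨a, ha⟩ := (Projectivization.mk_eq_mk_iff' L _ _ _ _).1 h
  simp only [Prod.smul_mk, smul_eq_mul, mul_one, Prod.mk.injEq] at ha
  rw [← ha.2, ha.1, one_mul]

theorem mk_eq_affinePoint_iff {u : L × L} (hu : u ≠ 0) (m : L) :
    Projectivization.mk L u hu = affinePoint m ↔ u.2 = m * u.1 := by
  rw [affinePoint, Projectivization.mk_eq_mk_iff']
  refine ⟨?_, fun h => ⟨u.1, ?_⟩⟩
  · rintro ⟨a, rfl⟩
    simp [mul_comm]
  · ext <;> simp [h, mul_comm]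

theorem linearSet_graph (f : L →ₗ[K] L) :
    linearSet f.graph = affinePoint '' directions f := by
  ext P
  constructor
  · rintro ⟨⟨x, y⟩, hu, hmem, rfl⟩
    rw [LinearMap.mem_graph_iff] at hmem
    simp only at hmem
    subst hmem
    have hx : x ≠ 0 := by rintro rfl; simp at hu
    refine ⟨f x / x, ⟨x, hx, by field_simp⟩, ?_⟩
    rw [eq_comm, mk_eq_affinePoint_iff]
    field_simp
  · rintro ⟨m, ⟨x, hx, h⟩, rfl⟩
    refine ⟨(x, f x), by simp [hx], by simp [LinearMap.mem_graph_iff], ?_⟩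
    rw [eq_comm, mk_eq_affinePoint_iff]
    exact h

theorem linearSet_graph_eq_iff (f g : L →ₗ[K] L) :
    linearSet f.graph = linearSet g.graph ↔ directions f = directions g := by
  rw [linearSet_graph, linearSet_graph, Set.image_eq_image affinePoint_injective]

theorem ncard_linearSet_graph (f : L →ₗ[K] L) :
    (linearSet f.graph).ncard = (directions f).ncard := by
  rw [linearSet_graph, Set.ncard_image_of_injective _ affinePoint_injective]

theorem finrank_graph (f : L →ₗ[K] L) : Module.finrank K f.graph = Module.finrank K L := by
  let e : L ≃ₗ[K] f.graph :=
    LinearEquiv.ofBijective (((LinearMap.id).prod f).codRestrict f.graph (fun x => by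
      simp [LinearMap.mem_graph_iff])) ⟨fun x y h => by simpa using congrArg (fun u => u.1.1) h,
      fun u => ⟨u.1.1, by
        have := u.2
        rw [LinearMap.mem_graph_iff] at this
        ext <;> simp [this]⟩⟩
  exact e.finrank_eq.symm

variable [Fintype K]

theorem sub_one_mul_sum_pow [Fintype L] :
    (Fintype.card K - 1) * ∑ i : Fin (Module.finrank K L), Fintype.card K ^ (i : ℕ) =
      Fintype.card L - 1 := by
  rw [Fin.sum_univ_eq_sum_range (fun i => Fintype.card K ^ i),
    Module.card_eq_pow_finrank (K := K) (V := L), mul_comm]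
  have hq : 1 ≤ Fintype.card K := Fintype.card_pos
  zify [hq, Nat.one_le_pow _ _ hq]
  exact geom_sum_mul _ _

variable [Finite L]

/-- A `K`-linear map `f` of `L` is scattered if its graph is a scattered subspace of `L²`. -/
def ScatteredMap (f : L →ₗ[K] L) : Prop :=
  ∀ m x y, x ≠ 0 → f x = m * x → f y = m * y → ∃ k : K, k • x = y

/-- Every fibre of x ↦ f(x)/x on the nonzero elements is a set K* x, of size q - 1. -/
theorem ncard_directions {f : L →ₗ[K] L} (hf : ScatteredMap f) :
    (directions f).ncard = ∑ i : Fin (Module.finrank K L), Fintype.card K ^ (i : ℕ) := by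
  classical
  have := Fintype.ofFinite L
  let A : Finset L := Finset.univ.filter fun x => x ≠ 0
  have hA : A.card = Fintype.card L - 1 := by
    simp [A, Finset.filter_ne']
  let T : Finset L := A.image fun x => f x / x
  have hT : (T : Set L) = directions f := by
    ext m
    simp only [T, A, Finset.coe_image, Finset.coe_filter, Finset.mem_univ, true_and,
      Set.mem_image, Set.mem_ofPred_eq, directions]
    refine exists_congr fun x => and_congr_right fun hx => ?_
    rw [div_eq_iff hx]
  have hfib : ∀ m ∈ T, (A.filter fun x => f x / x = m).card = Fintype.card K - 1 := by
    intro m hm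
    simp only [T, A, Finset.mem_image, Finset.mem_filter, Finset.mem_univ, true_and] at hm
    obtain ⟨x, hx, hxm⟩ := hm
    rw [div_eq_iff hx] at hxm
    rw [← card_units_smul (K := K) hx]
    congr 1
    ext y
    simp only [A, Finset.mem_filter, Finset.mem_univ, true_and, Finset.mem_image]
    constructor
    · rintro ⟨hy, hym⟩
      rw [div_eq_iff hy] at hym
      obtain ⟨k, rfl⟩ := hf m x y hx hxm hym
      have hk : k ≠ 0 := by rintro rfl; simp at hy
      exact ⟨Units.mk0 k hk, rfl⟩
    · rintro ⟨k, rfl⟩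
      have hk : (k : K) • x ≠ 0 := smul_ne_zero k.ne_zero hx
      refine ⟨hk, ?_⟩
      rw [div_eq_iff hk, map_smul, hxm, mul_smul_comm]
  have h1 := Finset.card_eq_sum_card_image (fun x => f x / x) A
  rw [Finset.sum_congr rfl hfib, Finset.sum_const, smul_eq_mul, hA, ← sub_one_mul_sum_pow (K := K),
    mul_comm] at h1
  have hq : 0 < Fintype.card K - 1 := Nat.sub_pos_of_lt Fintype.one_lt_card
  rw [← hT, Set.ncard_coe_finset]
  exact (Nat.eq_of_mul_eq_mul_right hq (by rw [mul_comm] at h1; linarith)).symm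

theorem isMaximumScattered_graph {f : L →ₗ[K] L} (hf : ScatteredMap f) :
    IsMaximumScattered K (linearSet f.graph) := by
  refine ⟨⟨f.graph, finrank_graph f, rfl⟩, ?_⟩
  rw [ncard_linearSet_graph, ncard_directions hf, Nat.card_eq_fintype_card,
    Fin.sum_univ_eq_sum_range (fun i => Fintype.card K ^ i), Nat.geomSum_eq Fintype.one_lt_card]

/-- The point ⟨(0, 1)⟩ is not on L_f, so the first projection is injective on `U`. Each point of L_f
takes at least q - 1 vectors of `U`, which makes `U` as large as L and the projection bijective. -/
theorem eq_graph_of_linearSet_eq {f : L →ₗ[K] L} (hf : ScatteredMap f) (U : Submodule K (L × L))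
    (hU : linearSet U = linearSet f.graph) : ∃ g : L →ₗ[K] L, U = g.graph := by
  classical
  have := Fintype.ofFinite L
  rw [linearSet_graph] at hU
  have hdir : ∀ u ∈ U, u ≠ 0 → ∃ m ∈ directions f, u.2 = m * u.1 := by
    intro u hu hu0
    have : Projectivization.mk L u hu0 ∈ affinePoint '' directions f := hU ▸ ⟨u, hu0, hu, rfl⟩
    obtain ⟨m, hm, h⟩ := this
    exact ⟨m, hm, (mk_eq_affinePoint_iff hu0 m).1 h.symm⟩
  have hne : ∀ u ∈ U, u ≠ 0 → u.1 ≠ 0 := by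
    intro u hu hu0 h
    obtain ⟨m, -, h2⟩ := hdir u hu hu0
    exact hu0 (Prod.ext h (by rw [h2, h, mul_zero]; rfl))
  have hinj : Function.Injective (Prod.fst ∘ U.subtype) := by
    intro u v h
    by_contra hne'
    refine hne (u - v : U) (u - v).2 (fun h0 => hne' ?_) ?_
    · exact sub_eq_zero.1 (Subtype.ext h0)
    · simpa [sub_eq_zero] using h
  refine Submodule.exists_eq_graph ((Fintype.bijective_iff_injective_and_card _).2 ⟨hinj, ?_⟩)
  refine le_antisymm (Fintype.card_le_of_injective _ hinj) ?_
  let A : Finset U := Finset.univ.filter fun u => u ≠ 0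
  have hA : A.card = Fintype.card U - 1 := by
    simp [A, Finset.filter_ne']
  let T : Finset L := (directions f).toFinset
  have hT : T.card = ∑ i : Fin (Module.finrank K L), Fintype.card K ^ (i : ℕ) := by
    rw [← ncard_directions hf, Set.ncard_eq_toFinset_card']
  have hle : (Fintype.card K - 1) * T.card ≤ A.card := by
    refine Finset.mul_card_image_le_card_of_maps_to (f := fun u : U => u.1.2 / u.1.1) ?_ _ ?_
    · intro u hu
      have hu0 : (u : L × L) ≠ 0 := by simpa [A] using hu
      obtain ⟨m, hm, h⟩ := hdir u u.2 hu0
      rw [h, mul_div_cancel_right₀ _ (hne u u.2 hu0)]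
      simpa [T] using hm
    · intro m hm
      have hm' : affinePoint m ∈ linearSet U := by
        rw [hU]; exact ⟨m, by simpa [T] using hm, rfl⟩
      obtain ⟨u, hu0, hu, hmu⟩ := hm'
      have hum := (mk_eq_affinePoint_iff hu0 m).1 hmu.symm
      have hu0' : (⟨u, hu⟩ : U) ≠ 0 := fun h => hu0 (congrArg Subtype.val h)
      rw [← card_units_smul (K := K) hu0']
      refine Finset.card_le_card fun v hv => ?_
      simp only [Finset.mem_image, Finset.mem_univ, true_and] at hv
      obtain ⟨k, rfl⟩ := hv
      have hk : (k : K) • (⟨u, hu⟩ : U) ≠ 0 := smul_ne_zero k.ne_zero hu0'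
      simp only [A, Finset.mem_filter, Finset.mem_univ, true_and]
      refine ⟨hk, ?_⟩
      have h1 : (k : K) • u.1 ≠ 0 := smul_ne_zero k.ne_zero (hne u hu hu0)
      change (k : K) • u.2 / (k : K) • u.1 = m
      rw [div_eq_iff h1, hum, mul_smul_comm]
  rw [hT, sub_one_mul_sum_pow, hA] at hle
  have : 0 < Fintype.card U := Fintype.card_pos
  omega

end Directions

/-! ### Adjoint maps have the same directions. -/

section Adjoint

variable {K L : Type*} [Field K] [Field L] [Algebra K L]

/-- If m is not a direction of f, then f - m is injective, hence surjective. A y with g(y) = m y is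
trace-orthogonal to its image, so y = 0. -/
theorem directions_subset_of_adjoint [FiniteDimensional K L] [Algebra.IsSeparable K L]
    {f g : L →ₗ[K] L}
    (h : ∀ x y, Algebra.trace K L (y * f x) = Algebra.trace K L (g y * x)) :
    directions g ⊆ directions f := by
  rintro m ⟨y, hy, hm⟩
  by_contra hcon
  have hinj : Function.Injective (f - LinearMap.mulLeft K m) := by
    rw [← LinearMap.ker_eq_bot, LinearMap.ker_eq_bot']
    intro x hx
    by_contra hx0
    exact hcon ⟨x, hx0, by simpa [sub_eq_zero] using hx⟩
  have hsurj := LinearMap.injective_iff_surjective.1 hinj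
  refine hy ((traceForm_nondegenerate K L).1 y fun z => ?_)
  obtain ⟨x, rfl⟩ := hsurj z
  rw [Algebra.traceForm_apply, LinearMap.sub_apply, mul_sub, map_sub, h, hm,
    LinearMap.mulLeft_apply, sub_eq_zero]
  congr 1
  ring

theorem directions_eq_of_adjoint [FiniteDimensional K L] [Algebra.IsSeparable K L]
    {f g : L →ₗ[K] L}
    (h : ∀ x y, Algebra.trace K L (y * f x) = Algebra.trace K L (g y * x)) :
    directions g = directions f := by
  refine (directions_subset_of_adjoint h).antisymm (directions_subset_of_adjoint fun x y => ?_)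
  rw [mul_comm, ← h, mul_comm]

end Adjoint

/-! ### The map ψ is scattered. -/

section Psi

variable (K L : Type*) [Field K] [Fintype K] [Field L] [Algebra K L]

/-- The adjoint of `ψ₁₀` with respect to the trace form. -/
noncomputable def psiAdj : L →ₗ[K] L :=
  (2 : L)⁻¹ • (frob K L 1 - frob K L 4 + frob K L 6 + frob K L 9)

variable {K L}

@[simp] theorem fr_two (i : ℕ) : fr K i (2 : L) = 2 := map_ofNat _ 2

theorem psi_apply (x : L) :
    psi K L 5 x = 2⁻¹ * (fr K 1 x + fr K 4 x - fr K 6 x + fr K 9 x) := by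
  simp [psi, frob_eq_fr]
  ring

theorem psiAdj_apply (x : L) :
    psiAdj K L x = 2⁻¹ * (fr K 1 x - fr K 4 x + fr K 6 x + fr K 9 x) := by
  simp [psiAdj, frob_eq_fr]
  ring

theorem two_ne_zero_of_card (hq : Fintype.card K ≡ 1 [MOD 4]) : (2 : L) ≠ 0 := by
  have h2 : (2 : K) ≠ 0 := by
    refine Ring.two_ne_zero fun h => ?_
    have := FiniteField.even_card_iff_char_two.1 h
    unfold Nat.ModEq at hq
    omega
  rw [← map_ofNat (algebraMap K L) 2]
  exact (map_ne_zero (algebraMap K L)).2 h2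

theorem exists_sq_eq_neg_one (hq : Fintype.card K ≡ 1 [MOD 4]) :
    ∃ i : L, i * i = -1 ∧ fr K 1 i = i := by
  have h : IsSquare (-1 : K) := FiniteField.isSquare_neg_one_iff.2 (by
    unfold Nat.ModEq at hq
    omega)
  obtain ⟨i, hi⟩ := h
  exact ⟨algebraMap K L i, by rw [← map_mul, ← hi]; simp, (fr K 1).commutes i⟩

variable [Finite L]

theorem trace_mul_fr (hn : Module.finrank K L = 10) {i j : ℕ} (hij : j + i = 10) (x y : L) :
    Algebra.trace K L (y * fr K i x) = Algebra.trace K L (fr K j y * x) := by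
  have : Module.Finite K L := Module.Finite.of_finite
  have h : ∀ z : L, Algebra.trace K L (fr K j z) = Algebra.trace K L z := fun z =>
    Algebra.trace_eq_of_algEquiv (AlgEquiv.ofBijective (fr K j) (Finite.injective_iff_bijective.1
      (fr_injective K j))) z
  rw [← h, map_mul, fr_fr, hij, ← hn, fr_finrank]

theorem directions_psiAdj (hn : Module.finrank K L = 10) :
    directions (psiAdj K L) = directions (psi K L 5) := by
  have : Module.Finite K L := Module.Finite.of_finite
  refine directions_eq_of_adjoint fun x y => ?_
  have e1 := trace_mul_fr hn (i := 1) (j := 9) rfl x (2⁻¹ * y)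
  have e4 := trace_mul_fr hn (i := 4) (j := 6) rfl x (2⁻¹ * y)
  have e6 := trace_mul_fr hn (i := 6) (j := 4) rfl x (2⁻¹ * y)
  have e9 := trace_mul_fr hn (i := 9) (j := 1) rfl x (2⁻¹ * y)
  have h1 : y * psi K L 5 x = 2⁻¹ * y * fr K 1 x + 2⁻¹ * y * fr K 4 x - 2⁻¹ * y * fr K 6 x
      + 2⁻¹ * y * fr K 9 x := by rw [psi_apply]; ring
  have hhalf : ∀ i, fr K i (2⁻¹ * y) = 2⁻¹ * fr K i y := by simp
  have h2 : psiAdj K L y * x = fr K 9 (2⁻¹ * y) * x + fr K 6 (2⁻¹ * y) * x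
      - fr K 4 (2⁻¹ * y) * x + fr K 1 (2⁻¹ * y) * x := by
    rw [psiAdj_apply]; simp only [hhalf]; ring
  rw [h1, h2]
  simp only [map_add, map_sub, e1, e4, e6, e9]

theorem fr_ten_add (hn : Module.finrank K L = 10) (i : ℕ) (x : L) :
    fr K (10 + i) x = fr K i x := by
  rw [← fr_mod K hn (10 + i), Nat.add_mod_left, fr_mod K hn]

omit [Finite L] in
/-- `ψ₁₀` acts on the sum of the eigenspaces of `x ↦ x ^ (q ^ 5)` componentwise. -/
theorem psi_components (h2 : (2 : L) ≠ 0)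
    {a b m n : L} (ha : fr K 5 a = a) (hb : fr K 5 b = -b) (hm : fr K 5 m = m)
    (hn' : fr K 5 n = -n) (h : psi K L 5 (a + b) = (m + n) * (a + b)) :
    fr K 4 a = m * a + n * b ∧ fr K 1 b = n * a + m * b := by
  have ha6 : fr K 6 a = fr K 1 a := by rw [← fr_fr K 1 5, ha]
  have ha9 : fr K 9 a = fr K 4 a := by rw [← fr_fr K 4 5, ha]
  have hb6 : fr K 6 b = -fr K 1 b := by rw [← fr_fr K 1 5, hb, map_neg]
  have hb9 : fr K 9 b = -fr K 4 b := by rw [← fr_fr K 4 5, hb, map_neg]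
  have h1 : fr K 4 a + fr K 1 b = (m + n) * (a + b) := by
    rw [← h, psi_apply]
    simp only [map_add, ha6, ha9, hb6, hb9]
    field_simp
    ring
  have h5 := congrArg (fr K 5) h1
  simp only [map_add, map_mul, ha, hb, hm, hn', fr_fr] at h5
  norm_num at h5
  rw [ha9, hb6] at h5
  constructor
  · apply mul_left_cancel₀ h2
    linear_combination h1 + h5
  · apply mul_left_cancel₀ h2
    linear_combination h1 - h5

theorem exists_components (hn : Module.finrank K L = 10) (h2 : (2 : L) ≠ 0) (x : L) :
    ∃ a b : L, fr K 5 a = a ∧ fr K 5 b = -b ∧ x = a + b := by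
  have h10 : fr K 5 (fr K 5 x) = x := by rw [fr_fr]; simpa using fr_ten_add hn 0 x
  refine ⟨2⁻¹ * (x + fr K 5 x), 2⁻¹ * (x - fr K 5 x), ?_, ?_, ?_⟩
  · simp [h10, add_comm]
  · simp [h10]; ring
  · field_simp; ring

omit [Finite L] in
theorem fr_eq_self_of_fr_one {x : L} (h : fr K 1 x = x) (i : ℕ) : fr K i x = x := by
  induction i with
  | zero => simp
  | succ i ih => rw [← fr_fr, h, ih]

omit [Finite L] in
theorem eq_zero_of_fr_five {x : L} (h2 : (2 : L) ≠ 0) (h : fr K 5 x = x) (h' : fr K 5 x = -x) :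
    x = 0 := by
  have : 2 * x = 0 := by linear_combination h' - h
  simpa [h2] using this

theorem scatteredMap_psi (hn : Module.finrank K L = 10) (hq : Fintype.card K ≡ 1 [MOD 4]) :
    ScatteredMap (psi K L 5) := by
  have h2 : (2 : L) ≠ 0 := two_ne_zero_of_card hq
  intro m x y hx hmx hmy
  obtain ⟨m₀, m₁, hm₀, hm₁, rfl⟩ := exists_components hn h2 m
  obtain ⟨a, b, ha, hb, rfl⟩ := exists_components hn h2 x
  obtain ⟨c, d, hc, hd, rfl⟩ := exists_components hn h2 y
  obtain ⟨ea, eb⟩ := psi_components h2 ha hb hm₀ hm₁ hmx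
  obtain ⟨ec, ed⟩ := psi_components h2 hc hd hm₀ hm₁ hmy
  have ea' : a = fr K 1 m₀ * fr K 1 a + fr K 1 m₁ * fr K 1 b := by
    have := congrArg (fr K 1) ea
    rw [fr_fr, map_add, map_mul, map_mul] at this
    exact ha.symm.trans this
  have ec' : c = fr K 1 m₀ * fr K 1 c + fr K 1 m₁ * fr K 1 d := by
    have := congrArg (fr K 1) ec
    rw [fr_fr, map_add, map_mul, map_mul] at this
    exact hc.symm.trans this
  -- If m = m₁, then a ≠ 0 would give m₁^(q+1) = 1, so m₁ is fixed by the square of Frobenius and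
  -- m₁^q = m₁^(q^5) = -m₁. Then m₁² = -1, so m₁ = ±i lies in K, contradicting m₁^(q^5) = -m₁.
  have hm₀0 : m₀ ≠ 0 := by
    rintro rfl
    simp only [map_zero, zero_mul, zero_add, add_zero] at ea ea' eb
    have ha0 : a = 0 := by
      by_contra ha0
      have hn1 : fr K 1 m₁ * m₁ = 1 := by
        apply mul_right_cancel₀ ha0
        rw [mul_assoc, ← eb, one_mul, ← ea']
      have hm₁0 : fr K 1 m₁ ≠ 0 := left_ne_zero_of_mul_eq_one hn1
      have h2m : fr K 2 m₁ = m₁ := by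
        have := congrArg (fr K 1) hn1
        rw [map_mul, fr_fr, map_one] at this
        apply mul_right_cancel₀ hm₁0
        rw [this, mul_comm, hn1]
      have h5m : fr K 5 m₁ = fr K 1 m₁ := by
        rw [← fr_fr K 1 4, ← fr_fr K 2 2, h2m, h2m]
      obtain ⟨i, hi, hi1⟩ := exists_sq_eq_neg_one (K := K) (L := L) hq
      have hmi : (m₁ - i) * (m₁ + i) = 0 := by
        rw [← h5m, hm₁] at hn1
        linear_combination -hn1 - hi
      have hfix : fr K 1 m₁ = m₁ := by
        rcases mul_eq_zero.1 hmi with h | h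
        · rw [sub_eq_zero.1 h, hi1]
        · rw [eq_neg_of_add_eq_zero_left h, map_neg, hi1]
      have := eq_zero_of_fr_five h2 (fr_eq_self_of_fr_one hfix 5) hm₁
      rw [this, mul_zero] at hn1
      exact zero_ne_one hn1
    have hb0 : b = 0 := by
      apply fr_injective K 1
      rw [eb, ha0, mul_zero, map_zero]
    exact hx (by rw [ha0, hb0, add_zero])
  -- The determinant times m₀ is fixed by Frobenius but negated by its fifth power.
  have hD : a * d = b * c := by
    have h1 : fr K 1 (m₀ * (a * d - b * c)) = m₀ * (a * d - b * c) := by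
      simp only [map_mul, map_sub]
      linear_combination (-fr K 1 d) * ea' + fr K 1 b * ec' + a * ed - c * eb
    have h5 : fr K 5 (m₀ * (a * d - b * c)) = -(m₀ * (a * d - b * c)) := by
      simp only [map_mul, map_sub, ha, hb, hc, hd, hm₀]
      ring
    have := eq_zero_of_fr_five h2 (fr_eq_self_of_fr_one h1 5) h5
    simpa [hm₀0, sub_eq_zero] using this
  obtain ⟨l, hl⟩ : ∃ l, l = (c + d) / (a + b) := ⟨_, rfl⟩
  have hlc : c = l * a := by rw [hl]; field_simp; linear_combination -hD
  have hld : d = l * b := by rw [hl]; field_simp; linear_combination hD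
  have hfix : fr K 1 l = l := by
    -- The -1 component alone gives l^q = l when b ≠ 0. If b = 0, the +1 component gives only
    -- l^(q^4) = l, which is combined with l^(q^5) = l.
    by_cases hb0 : b = 0
    · have ha0 : a ≠ 0 := by rintro rfl; exact hx (by rw [hb0, add_zero])
      have h5 : fr K 5 l = l := by
        apply mul_right_cancel₀ ha0
        rw [← hlc, ← hc, hlc, map_mul, ha]
      have h4 : fr K 4 l = l := by
        have ha4 : fr K 4 a ≠ 0 := (map_ne_zero (fr K 4)).2 ha0
        apply mul_right_cancel₀ ha4
        rw [← map_mul, ← hlc, ec, ea, hld, hlc]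
        ring
      calc fr K 1 l = fr K 1 (fr K 4 l) := by rw [h4]
        _ = l := by rw [fr_fr, h5]
    · have hb1 : fr K 1 b ≠ 0 := (map_ne_zero (fr K 1)).2 hb0
      apply mul_right_cancel₀ hb1
      rw [← map_mul, ← hld, ed, eb, hld, hlc]
      ring
  obtain ⟨k, hk⟩ := (fr_one_eq_self_iff K l).1 hfix
  exact ⟨k, by rw [Algebra.smul_def, hk, hlc, hld]; ring⟩

end Psi

/-! ### Coefficients of a map with the minors of ψ, and Hilbert 90. -/

section Classification

variable {K L : Type*} [Field K] [Fintype K] [Field L] [Algebra K L]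

variable (L) in
/-- The coefficients of `ψ₁₀` as a linearized polynomial. -/
def psiCoeff : Fin 10 → L := ![0, 2⁻¹, 0, 0, 2⁻¹, 0, -2⁻¹, 0, 0, 2⁻¹]

theorem linPoly_psiCoeff : linPoly K (psiCoeff L) = psi K L 5 := by
  ext x
  rw [linPoly_apply, psi_apply]
  simp [psiCoeff, Fin.sum_univ_succ]
  ring

theorem dickson_apply (β : Fin 10 → L) (i j : Fin 10) :
    dickson K β i j = fr K (i : ℕ) (β (j - i)) := rfl

/-- Permutations supported on a 4-cycle: two perfect matchings and the two orientations. A 5-cycle,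
below, has no perfect matching. -/
theorem det_cycle_four {R : Type*} [CommRing R] (a b c d a' b' c' d' : R) :
    Matrix.det !![0, a, 0, d'; a', 0, b, 0; 0, b', 0, c; d, 0, c', 0] =
      a * a' * (c * c') + b * b' * (d * d') - a * b * c * d - a' * b' * c' * d' := by
  simp [Matrix.det_succ_row_zero, Fin.sum_univ_succ, Fin.succAbove]
  ring

theorem det_cycle_five {R : Type*} [CommRing R] (a b c d e a' b' c' d' e' : R) :
    Matrix.det !![0, a, 0, 0, e'; a', 0, b, 0, 0; 0, b', 0, c, 0; 0, 0, c', 0, d;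
      e, 0, 0, d', 0] = a * b * c * d * e + a' * b' * c' * d' * e' := by
  simp [Matrix.det_succ_row_zero, Fin.sum_univ_succ, Fin.succAbove]
  ring

/-- The two orientation products, scaled by 16, have sum 2s and product 1 = s², so both are the
double root s. -/
theorem eq_of_cycle_four {R : Type*} [CommRing R] [IsDomain R] {a b c d a' b' c' d' s : R}
    (hs : s ^ 2 = 1) (h1 : 4 * (a * a') * (4 * (c * c')) = 1)
    (h2 : 4 * (b * b') * (4 * (d * d')) = 1)
    (h : 16 * (a * a' * (c * c') + b * b' * (d * d') - a * b * c * d - a' * b' * c' * d') =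
      2 - 2 * s) : 16 * (a * b * c * d) = s := by
  have hprod : 256 * ((a * b * c * d) * (a' * b' * c' * d')) = 1 := by
    linear_combination 16 * (b * b' * (d * d')) * h1 + h2
  have hsum : 16 * (a * b * c * d) + 16 * (a' * b' * c' * d') = 2 * s := by
    linear_combination h1 + h2 - h
  have : (16 * (a * b * c * d) - s) ^ 2 = 0 := by
    linear_combination 16 * (a * b * c * d) * hsum - hprod + hs
  exact sub_eq_zero.1 (pow_eq_zero_iff two_ne_zero |>.1 this)

/-- The index order makes neighbours differ by ±1 or ±4, the exponents in the support of ψ; the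
diagonals of the 4-cycle have differences ±3 and 5. -/
theorem dickson_submatrix_four (γ : Fin 10 → L) (h0 : γ 0 = 0) (h3 : γ 3 = 0) (h5 : γ 5 = 0)
    (h7 : γ 7 = 0) :
    (dickson K γ).submatrix ![0, 1, 5, 4] ![0, 1, 5, 4] =
      !![0, γ 1, 0, γ 4; fr K 1 (γ 9), 0, fr K 1 (γ 4), 0; 0, fr K 5 (γ 6), 0, fr K 5 (γ 9);
        fr K 4 (γ 6), 0, fr K 4 (γ 1), 0] := by
  have n1 : (-1 : Fin 10) = 9 := by decide
  have n4 : (-4 : Fin 10) = 6 := by decide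
  have n5 : (-5 : Fin 10) = 5 := by decide
  ext i j
  fin_cases i <;> fin_cases j <;> simp [dickson_apply, h0, h5, h3, h7, n1, n4, n5]

theorem dickson_submatrix_four' (γ : Fin 10 → L) (h0 : γ 0 = 0) (h5 : γ 5 = 0) :
    (dickson K γ).submatrix ![0, 1, 5, 6] ![0, 1, 5, 6] =
      !![0, γ 1, 0, γ 6; fr K 1 (γ 9), 0, fr K 1 (γ 4), 0; 0, fr K 5 (γ 6), 0, fr K 5 (γ 1);
        fr K 6 (γ 4), 0, fr K 6 (γ 9), 0] := by
  have n1 : (-1 : Fin 10) = 9 := by decide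
  have n5 : (-5 : Fin 10) = 5 := by decide
  have n6 : (-6 : Fin 10) = 4 := by decide
  ext i j
  fin_cases i <;> fin_cases j <;> simp [dickson_apply, h0, h5, n1, n5, n6]

theorem dickson_submatrix_five (γ : Fin 10 → L) (h0 : γ 0 = 0) (h2 : γ 2 = 0) (h8 : γ 8 = 0) :
    (dickson K γ).submatrix ![0, 4, 8, 2, 6] ![0, 4, 8, 2, 6] =
      !![0, γ 4, 0, 0, γ 6; fr K 4 (γ 6), 0, fr K 4 (γ 4), 0, 0;
        0, fr K 8 (γ 6), 0, fr K 8 (γ 4), 0; 0, 0, fr K 2 (γ 6), 0, fr K 2 (γ 4);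
        fr K 6 (γ 4), 0, 0, fr K 6 (γ 6), 0] := by
  have n2 : (-2 : Fin 10) = 8 := by decide
  have n4 : (-4 : Fin 10) = 6 := by decide
  have n6 : (-6 : Fin 10) = 4 := by decide
  have n8 : (-8 : Fin 10) = 2 := by decide
  ext i j
  fin_cases i <;> fin_cases j <;> simp [dickson_apply, h0, h2, h8, n2, n4, n6, n8]

variable [Finite L]

/-- The support of the coefficients, and the products over the cycles. -/
theorem coeff_relations (hn : Module.finrank K L = 10) (h2 : (2 : L) ≠ 0) (β : Fin 10 → L)
    (hβ : ∀ (k : ℕ) (e : Fin k → Fin 10), Function.Injective e →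
      ((dickson K β).submatrix e e).det = ((dickson K (psiCoeff L)).submatrix e e).det) :
    (β 0 = 0 ∧ β 2 = 0 ∧ β 3 = 0 ∧ β 5 = 0 ∧ β 7 = 0 ∧ β 8 = 0) ∧
    4 * (β 1 * fr K 1 (β 9)) = 1 ∧ 4 * (β 4 * fr K 4 (β 6)) = -1 ∧
    16 * (β 1 * fr K 1 (β 4) * fr K 5 (β 9) * fr K 4 (β 6)) = -1 ∧
    16 * (β 1 * fr K 1 (β 4) * fr K 5 (β 1) * fr K 6 (β 4)) = 1 ∧
    (32 * (β 4 * fr K 4 (β 4) * fr K 8 (β 4) * fr K 2 (β 4) * fr K 6 (β 4))) ^ 2 = 1 := by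
  have n1 : (-1 : Fin 10) = 9 := by decide
  have n2 : (-2 : Fin 10) = 8 := by decide
  have n3 : (-3 : Fin 10) = 7 := by decide
  have n4 : (-4 : Fin 10) = 6 := by decide
  have n5 : (-5 : Fin 10) = 5 := by decide
  have b0 := hβ 1 ![0] (by decide)
  have m01 := hβ 2 ![0, 1] (by decide)
  have m02 := hβ 2 ![0, 2] (by decide)
  have m03 := hβ 2 ![0, 3] (by decide)
  have m04 := hβ 2 ![0, 4] (by decide)
  have m05 := hβ 2 ![0, 5] (by decide)
  have m012 := hβ 3 ![0, 1, 2] (by decide)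
  have m014 := hβ 3 ![0, 1, 4] (by decide)
  have m0154 := hβ 4 ![0, 1, 5, 4] (by decide)
  have m0156 := hβ 4 ![0, 1, 5, 6] (by decide)
  have m04826 := hβ 5 ![0, 4, 8, 2, 6] (by decide)
  simp only [Matrix.det_fin_one, Matrix.submatrix_apply, dickson_apply] at b0
  simp [psiCoeff] at b0
  simp only [Matrix.det_fin_two, Matrix.submatrix_apply, dickson_apply] at m01 m02 m03 m04 m05
  simp [psiCoeff, b0, n1, n2, n3, n4, n5] at m01 m02 m03 m04 m05
  simp only [Matrix.det_fin_three, Matrix.submatrix_apply, dickson_apply] at m012 m014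
  simp [psiCoeff, b0, n1, n2, n4] at m012 m014
  have e1 : 4 * (β 1 * fr K 1 (β 9)) = 1 := by rw [m01]; field_simp; norm_num
  have e4 : 4 * (β 4 * fr K 4 (β 6)) = -1 := by
    rw [← neg_neg (β 4 * _), m04]; field_simp; norm_num
  have h4 : (4 : L) ≠ 0 := by
    have : (4 : L) = 2 * 2 := by norm_num
    rw [this]; exact mul_ne_zero h2 h2
  have b1 : β 1 ≠ 0 := by intro h; simp [h] at e1
  have b9 : β 9 ≠ 0 := by intro h; simp [h] at e1
  have b4 : β 4 ≠ 0 := by intro h; simp [h] at e4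
  have b6 : β 6 ≠ 0 := by intro h; simp [h] at e4
  -- Once one of the two vanishes, a single 3-cycle product survives in the minor, and its other
  -- factors are nonzero.
  have b28 : β 2 = 0 ∧ β 8 = 0 := by
    rcases m02 with h | h <;> simpa [h, b1, b9] using m012
  have b37 : β 3 = 0 ∧ β 7 = 0 := by
    rcases m03 with h | h <;> simpa [h, b1, b9, b4, b6] using m014
  have hf4 : ∀ i, fr K i (4 : L) = 4 := fun i => map_ofNat _ 4
  have e1' : ∀ i, 4 * (fr K i (β 1) * fr K (i + 1) (β 9)) = 1 := fun i => by
    simpa [fr_fr, hf4] using congrArg (fr K i) e1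
  have e4' : ∀ i, 4 * (fr K i (β 4) * fr K (i + 4) (β 6)) = -1 := fun i => by
    simpa [fr_fr, hf4] using congrArg (fr K i) e4
  have hfr : ∀ i x, fr K (10 + i) x = fr K i x := fr_ten_add (K := K) (L := L) hn
  refine ⟨⟨b0, b28.1, b37.1, m05, b37.2, b28.2⟩, e1, e4, ?_, ?_, ?_⟩
  · rw [dickson_submatrix_four β b0 b37.1 m05 b37.2, dickson_submatrix_four _ rfl rfl rfl rfl,
      det_cycle_four, det_cycle_four] at m0154
    refine eq_of_cycle_four (a' := fr K 1 (β 9)) (b' := fr K 5 (β 6)) (c' := fr K 4 (β 1))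
      (d' := β 4) (by norm_num) ?_ ?_ ?_
    · linear_combination 4 * (fr K 5 (β 9) * fr K 4 (β 1)) * e1 + e1' 4
    · linear_combination 4 * (fr K 4 (β 6) * β 4) * e4' 1 - e4
    · rw [m0154]
      simp [psiCoeff]
      field_simp
      norm_num
  · rw [dickson_submatrix_four' β b0 m05, dickson_submatrix_four' _ rfl rfl,
      det_cycle_four, det_cycle_four] at m0156
    have e46 : 4 * (fr K 6 (β 4) * β 6) = -1 := by
      have := e4' 6
      rwa [hfr 0, fr_zero] at this
    refine eq_of_cycle_four (a' := fr K 1 (β 9)) (b' := fr K 5 (β 6)) (c' := fr K 6 (β 9))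
      (d' := β 6) (by norm_num) ?_ ?_ ?_
    · linear_combination 4 * (fr K 5 (β 1) * fr K 6 (β 9)) * e1 + e1' 5
    · linear_combination 4 * (fr K 6 (β 4) * β 6) * e4' 1 - e46
    · rw [m0156]
      simp [psiCoeff]
      right
      ring
  · rw [dickson_submatrix_five β b0 b28.1 b28.2, dickson_submatrix_five _ rfl rfl rfl,
      det_cycle_five, det_cycle_five] at m04826
    have e44 := e4' 4
    have e48 : 4 * (fr K 8 (β 4) * fr K 2 (β 6)) = -1 := by
      have := e4' 8
      rwa [hfr 2] at this
    have e42 := e4' 2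
    have e46 : 4 * (fr K 6 (β 4) * β 6) = -1 := by
      have := e4' 6
      rwa [hfr 0, fr_zero] at this
    norm_num at e44 e42
    have hsum : β 4 * fr K 4 (β 4) * fr K 8 (β 4) * fr K 2 (β 4) * fr K 6 (β 4) +
        fr K 4 (β 6) * fr K 8 (β 6) * fr K 2 (β 6) * fr K 6 (β 6) * β 6 = 0 := by
      rw [m04826]
      simp [psiCoeff]
    have hprod : (4 * (β 4 * fr K 4 (β 6))) * (4 * (fr K 4 (β 4) * fr K 8 (β 6))) *
        (4 * (fr K 8 (β 4) * fr K 2 (β 6))) * (4 * (fr K 2 (β 4) * fr K 6 (β 6))) *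
        (4 * (fr K 6 (β 4) * β 6)) = -1 := by
      rw [e4, e44, e48, e42, e46]; norm_num
    -- The two orientation products X, X' satisfy X + X' = 0 and 1024 X X' = -1.
    linear_combination 1024 * (β 4 * fr K 4 (β 4) * fr K 8 (β 4) * fr K 2 (β 4) * fr K 6 (β 4)) *
      hsum - hprod

omit [Finite L] in
/-- Hilbert's Theorem 90 for finite fields. -/
theorem exists_fr_one_eq_mul [Fintype L] {u : L}
    (hu : u ^ ((Fintype.card L - 1) / (Fintype.card K - 1)) = 1) :
    ∃ c : L, c ≠ 0 ∧ fr K 1 c = u * c := by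
  have hq : 0 < Fintype.card K - 1 := Nat.sub_pos_of_lt Fintype.one_lt_card
  have hQ : 0 < Fintype.card L - 1 := Nat.sub_pos_of_lt Fintype.one_lt_card
  have hdvd : Fintype.card K - 1 ∣ Fintype.card L - 1 := by
    rw [← sub_one_mul_sum_pow (K := K) (L := L)]; exact dvd_mul_right _ _
  obtain ⟨N, hN⟩ := hdvd
  have hN0 : 0 < N := Nat.pos_of_ne_zero (by rintro rfl; omega)
  rw [hN, Nat.mul_div_cancel_left _ hq] at hu
  have hu0 : u ≠ 0 := by rintro rfl; simp [hN0.ne'] at hu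
  obtain ⟨g, hg⟩ := IsCyclic.exists_generator (α := Lˣ)
  obtain ⟨k, hk⟩ := (mem_powers_iff_mem_zpowers (x := g)).2 (hg (Units.mk0 u hu0))
  have hk' : g ^ k = Units.mk0 u hu0 := hk
  have horder : orderOf g = Fintype.card L - 1 := by
    classical
    rw [orderOf_eq_card_of_forall_mem_zpowers hg, Nat.card_eq_fintype_card, Fintype.card_units]
  have h1 : g ^ (k * N) = 1 := by
    rw [pow_mul, hk']; ext; simpa using hu
  have h2 := orderOf_dvd_of_pow_eq_one h1
  rw [horder, hN] at h2
  obtain ⟨l, rfl⟩ := Nat.dvd_of_mul_dvd_mul_right hN0 h2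
  refine ⟨(g ^ l : Lˣ), Units.ne_zero _, ?_⟩
  have hc : (Units.mk0 u hu0 : L) = u := rfl
  rw [fr_apply, pow_one, ← hc, ← hk', ← Units.val_pow_eq_pow_val, ← Units.val_mul]
  congr 1
  rw [← pow_mul, ← pow_add]
  congr 1
  have : Fintype.card K = Fintype.card K - 1 + 1 := by omega
  conv_lhs => rw [this]
  ring

end Classification

/-! ### Only ψ and its adjoint occur, up to scaling. -/

section Uniqueness

variable {K L : Type*} [Field K] [Fintype K] [Field L] [Algebra K L] [Finite L]

/-- The aim is 2b₁ = c^(q-1), for which 2b₁ must have norm 1. The remaining freedom is the sign k in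
2b₄ = k c^(q^4-1); b₆ and b₉ then follow from `e4` and `e1`. -/
theorem exists_scaling (hn : Module.finrank K L = 10) (h2 : (2 : L) ≠ 0) {b₁ b₄ b₆ b₉ : L}
    (e1 : 4 * (b₁ * fr K 1 b₉) = 1) (e4 : 4 * (b₄ * fr K 4 b₆) = -1)
    (hc : 16 * (b₁ * fr K 1 b₄ * fr K 5 b₉ * fr K 4 b₆) = -1)
    (hc' : 16 * (b₁ * fr K 1 b₄ * fr K 5 b₁ * fr K 6 b₄) = 1)
    (hc5 : (32 * (b₄ * fr K 4 b₄ * fr K 8 b₄ * fr K 2 b₄ * fr K 6 b₄)) ^ 2 = 1) :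
    ∃ c k : L, c ≠ 0 ∧ (k = 1 ∨ k = -1) ∧ c * b₁ = 2⁻¹ * fr K 1 c ∧ c * b₄ = 2⁻¹ * k * fr K 4 c ∧
      c * b₆ = -(2⁻¹ * k * fr K 6 c) ∧ c * b₉ = 2⁻¹ * fr K 9 c := by
  have := Fintype.ofFinite L
  have hfr : ∀ i x, fr K (10 + i) x = fr K i x := fr_ten_add (K := K) (L := L) hn
  have hf4 : ∀ i, fr K i (4 : L) = 4 := fun i => map_ofNat _ 4
  have b1 : b₁ ≠ 0 := by rintro rfl; simp at e1
  have e15 : 4 * (fr K 4 b₁ * fr K 5 b₉) = 1 := by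
    simpa [fr_fr, hf4] using congrArg (fr K 4) e1
  have hPQ : fr K 5 b₉ * fr K 4 b₆ ≠ 0 := by
    intro h
    have : 16 * (b₁ * fr K 1 b₄ * (fr K 5 b₉ * fr K 4 b₆)) = -1 := by rw [← hc]; ring
    simp [h] at this
  have h16 : (16 : L) ≠ 0 := by
    have : (16 : L) = 2 ^ 4 := by norm_num
    rw [this]; exact pow_ne_zero _ h2
  have hrel : b₁ * fr K 1 b₄ = fr K 4 b₁ * b₄ := by
    apply mul_right_cancel₀ hPQ
    apply mul_left_cancel₀ h16
    linear_combination hc - 4 * (b₄ * fr K 4 b₆) * e15 - e4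
  obtain ⟨u, hu⟩ : ∃ u, u = 2 * b₁ := ⟨_, rfl⟩
  obtain ⟨v, hv⟩ : ∃ v, v = 2 * b₄ := ⟨_, rfl⟩
  have hu0 : u ≠ 0 := by rw [hu]; exact mul_ne_zero h2 b1
  have hui : ∀ i, fr K i u ≠ 0 := fun i => (map_ne_zero (fr K i)).2 hu0
  have hub : ∀ i, fr K i u = 2 * fr K i b₁ := fun i => by rw [hu, map_mul, fr_two]
  have hvb : ∀ i, fr K i v = 2 * fr K i b₄ := fun i => by rw [hv, map_mul, fr_two]
  -- If u = c^(q-1), the bracket is c^(q^4-1), so k compares v with its expected value; `hrel` says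
  -- exactly that k is fixed by Frobenius.
  obtain ⟨k, hk⟩ : ∃ k, v = k * (u * fr K 1 u * fr K 2 u * fr K 3 u) :=
    ⟨v / (u * fr K 1 u * fr K 2 u * fr K 3 u), by
      rw [div_mul_cancel₀]
      simp [hu0, hui]⟩
  have hvi : ∀ i, fr K i v = fr K i k *
      (fr K i u * fr K (i + 1) u * fr K (i + 2) u * fr K (i + 3) u) := fun i => by
    rw [hk]; simp only [map_mul, fr_fr]
  have hk1 : fr K 1 k = k := by
    have h1 : u * fr K 1 v = fr K 4 u * v := by
      rw [hub, hvb, hu, hv]; linear_combination 4 * hrel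
    rw [hvi, hk] at h1
    have h5 : u * fr K 1 u * fr K 2 u * fr K 3 u * fr K 4 u ≠ 0 := by simp [hu0, hui]
    apply mul_right_cancel₀ h5
    linear_combination h1
  have hki := fr_eq_self_of_fr_one (K := K) hk1
  obtain ⟨N, hN⟩ : ∃ N, N = u * fr K 1 u * fr K 2 u * fr K 3 u * fr K 4 u * fr K 5 u * fr K 6 u *
    fr K 7 u * fr K 8 u * fr K 9 u := ⟨_, rfl⟩
  have hkN : k ^ 2 * N = 1 := by
    have h1 : u * fr K 1 v * fr K 5 u * fr K 6 v = 1 := by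
      rw [hub, hvb, hvb, hu]; linear_combination hc'
    rw [hvi 1, hvi 6, hki, hki] at h1
    rw [← h1, hN]
    ring
  have h10 : fr K 10 u = u := by simpa using hfr 0 u
  have h11 : fr K 11 u = fr K 1 u := hfr 1 u
  have hk2 : k ^ 2 = 1 := by
    have h1 : (v * fr K 4 v * fr K 8 v * fr K 2 v * fr K 6 v) ^ 2 = 1 := by
      rw [hvb, hvb, hvb, hvb, hv]; linear_combination hc5
    -- Five blocks of four consecutive conjugates, starting at the even exponents, cover each
    -- conjugate of u twice: the product is k^5 N².
    have h3 : v * fr K 4 v * fr K 8 v * fr K 2 v * fr K 6 v = k * (k ^ 2 * N) ^ 2 := by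
      rw [hvi 4, hvi 8, hvi 2, hvi 6, hki, hki, hki, hki, hk, hN]
      norm_num [h10, h11]
      ring
    rwa [h3, hkN, one_pow, mul_one] at h1
  have hN1 : N = 1 := by simpa [hk2] using hkN
  have hnorm : u ^ ((Fintype.card L - 1) / (Fintype.card K - 1)) = 1 := by
    have hq : 0 < Fintype.card K - 1 := Nat.sub_pos_of_lt Fintype.one_lt_card
    rw [← sub_one_mul_sum_pow (K := K) (L := L), Nat.mul_div_cancel_left _ hq, hn,
      ← Finset.prod_pow_eq_pow_sum, ← hN1, hN]
    simp only [← fr_apply]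
    simp [Fin.prod_univ_succ]
    ring
  obtain ⟨c, hc0, hcu⟩ := exists_fr_one_eq_mul hnorm
  have hci : ∀ i, fr K (i + 1) c = fr K i u * fr K i c := fun i => by
    rw [← fr_fr, hcu, map_mul]
  have hc4 : v * c = k * fr K 4 c := by
    rw [hci 3, hci 2, hci 1, hcu, hk]; ring
  have hc10 : ∀ i j, i + j = 10 → fr K i (fr K j c) = c := fun i j hij => by
    rw [fr_fr, hij]; simpa using hfr 0 c
  have hkk : k * k = 1 := by rw [← sq, hk2]
  refine ⟨c, k, hc0, by simpa using hk2, ?_, ?_, ?_, ?_⟩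
  · apply mul_left_cancel₀ h2
    rw [hcu, hu]; field_simp
  · apply mul_left_cancel₀ h2
    field_simp
    rw [← hc4, hv]; ring
  · apply fr_injective K 4
    have h4 : fr K 4 c = k * v * c := by linear_combination -k * hc4 - fr K 4 c * hkk
    simp only [map_mul, map_neg, map_inv₀, fr_two, hki, hc10 4 6 rfl]
    apply mul_left_cancel₀ h2
    field_simp
    rw [h4, hv]
    linear_combination k * c * e4
  · apply fr_injective K 1
    simp only [map_mul, map_inv₀, fr_two, hc10 1 9 rfl]
    apply mul_left_cancel₀ h2
    field_simp
    rw [hcu, hu]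
    linear_combination c * e1

theorem directions_eq_imp (hn : Module.finrank K L = 10)
    (hq : Fintype.card K ≡ 1 [MOD 4]) {g : L →ₗ[K] L}
    (hg : directions g = directions (psi K L 5)) :
    ∃ c : L, c ≠ 0 ∧
      ((∀ x, c * g x = psi K L 5 (c * x)) ∨ (∀ x, c * g x = psiAdj K L (c * x))) := by
  have h2 : (2 : L) ≠ 0 := two_ne_zero_of_card hq
  obtain ⟨β, rfl⟩ := linPoly_surjective K hn g
  have hfin : (directions (psi K L 5)).Finite := Set.toFinite _
  have hcard : ∑ i : Fin 10, Fintype.card K ^ (i : ℕ) ≤ hfin.toFinset.card := by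
    rw [← Set.ncard_eq_toFinset_card _ hfin, ncard_directions (scatteredMap_psi hn hq), hn]
  have hminor := fun k e he => dickson_minor_eq K hn β (psiCoeff L) hfin.toFinset hcard
    (fun m hm => by rwa [Set.Finite.mem_toFinset, ← hg] at hm)
    (fun m hm => by rwa [Set.Finite.mem_toFinset, ← linPoly_psiCoeff] at hm) (k := k) e he
  obtain ⟨⟨b0, b2, b3, b5, b7, b8⟩, e1, e4, hc, hc', hc5⟩ := coeff_relations hn h2 β hminor
  obtain ⟨c, k, hc0, hk, h1, h4, h6, h9⟩ := exists_scaling hn h2 e1 e4 hc hc' hc5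
  have hexp : ∀ x, c * linPoly K β x =
      2⁻¹ * (fr K 1 (c * x) + k * fr K 4 (c * x) - k * fr K 6 (c * x) + fr K 9 (c * x)) := by
    intro x
    have : linPoly K β x = β 1 * fr K 1 x + β 4 * fr K 4 x + β 6 * fr K 6 x + β 9 * fr K 9 x := by
      rw [linPoly_apply]
      simp [Fin.sum_univ_succ, b0, b2, b3, b5, b7, b8]
      ring
    rw [this]
    simp only [map_mul]
    linear_combination fr K 1 x * h1 + fr K 4 x * h4 + fr K 6 x * h6 + fr K 9 x * h9
  refine ⟨c, hc0, ?_⟩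
  rcases hk with rfl | rfl
  · left
    intro x
    rw [hexp, psi_apply]
    ring
  · right
    intro x
    rw [hexp, psiAdj_apply]
    ring

end Uniqueness

/-! ### The two classes of a linear set: `HasZClass` and `IsSimple`. -/

section Orbits

variable {K L : Type*} [Field K] [Fintype K] [Field L] [Algebra K L]

omit [Fintype K] in
theorem mem_units_smul_iff (U : Submodule K (L × L)) (c : Lˣ) (u : L × L) :
    u ∈ c • U ↔ c⁻¹ • u ∈ U := by
  constructor
  · rintro ⟨v, hv, rfl⟩
    rw [SetLike.mem_coe] at hv
    convert hv
    exact inv_smul_smul c v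
  · intro h
    exact ⟨_, h, smul_inv_smul c u⟩

omit [Fintype K] in
theorem graph_eq_smul_graph {f g : L →ₗ[K] L} {c : L} (hc : c ≠ 0)
    (h : ∀ x, c * g x = f (c * x)) : g.graph = (Units.mk0 c hc)⁻¹ • f.graph := by
  ext ⟨x, y⟩
  rw [mem_units_smul_iff, inv_inv, LinearMap.mem_graph_iff, LinearMap.mem_graph_iff]
  change y = g x ↔ c * y = f (c * x)
  rw [← h, mul_right_inj' hc]

theorem gammaLEquiv_of_linearEquiv (e : (L × L) ≃ₗ[L] (L × L)) {A B : Set (L × L)}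
    (h : ∀ u, u ∈ A ↔ e u ∈ B) : GammaLEquiv A B := by
  refine ⟨RingEquiv.refl L,
    { toFun := e, map_add' := e.map_add, map_smul' := fun c u => e.map_smul c u },
    e.bijective, ?_⟩
  ext v
  constructor
  · rintro ⟨u, hu, rfl⟩
    exact (h u).1 hu
  · intro hv
    exact ⟨e.symm v, (h _).2 (by simpa using hv), e.apply_symm_apply v⟩

variable [Finite L]

/-- ψ is an isometry of the trace form; hence the coordinate swap, a linear map, joins the two
scalar classes into one ΓL-orbit. -/
theorem psi_psiAdj (hn : Module.finrank K L = 10) (h2 : (2 : L) ≠ 0) (x : L) :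
    psi K L 5 (psiAdj K L x) = x := by
  have hfr : ∀ i x, fr K (10 + i) x = fr K i x := fr_ten_add (K := K) (L := L) hn
  have h10 : fr K 10 x = x := by simpa using hfr 0 x
  rw [psi_apply, psiAdj_apply]
  simp only [map_mul, map_add, map_sub, map_inv₀, fr_two, fr_fr]
  norm_num [h10, hfr 2, hfr 3, hfr 5, hfr 8]
  field_simp
  ring

theorem psiAdj_psi (hn : Module.finrank K L = 10) (h2 : (2 : L) ≠ 0) (x : L) :
    psiAdj K L (psi K L 5 x) = x := by
  have hinj : Function.Injective (psi K L 5) :=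
    Finite.injective_iff_surjective.2 fun y => ⟨_, psi_psiAdj hn h2 y⟩
  exact hinj (psi_psiAdj hn h2 _)

theorem swap_mem_graph_psi_iff (hn : Module.finrank K L = 10) (h2 : (2 : L) ≠ 0) (u : L × L) :
    u.swap ∈ (psi K L 5).graph ↔ u ∈ (psiAdj K L).graph := by
  rw [LinearMap.mem_graph_iff, LinearMap.mem_graph_iff, Prod.fst_swap, Prod.snd_swap]
  constructor
  · intro h; rw [h, psiAdj_psi hn h2]
  · intro h; rw [h, psi_psiAdj hn h2]

/-- The subspaces that define the linear set of `ψ₁₀`. -/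
theorem eq_smul_graph_of_linearSet_eq (hn : Module.finrank K L = 10)
    (hq : Fintype.card K ≡ 1 [MOD 4]) (U : Submodule K (L × L))
    (hU : linearSet U = linearSet (psi K L 5).graph) :
    ∃ c : Lˣ, U = c • (psi K L 5).graph ∨ U = c • (psiAdj K L).graph := by
  obtain ⟨g, rfl⟩ := eq_graph_of_linearSet_eq (scatteredMap_psi hn hq) U hU
  rw [linearSet_graph_eq_iff] at hU
  obtain ⟨c, hc, h⟩ := directions_eq_imp hn hq hU
  exact ⟨(Units.mk0 c hc)⁻¹, h.imp (graph_eq_smul_graph hc) (graph_eq_smul_graph hc)⟩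

theorem exists_linearEquiv_graph_psi (hn : Module.finrank K L = 10)
    (hq : Fintype.card K ≡ 1 [MOD 4]) (U : Submodule K (L × L))
    (hU : linearSet U = linearSet (psi K L 5).graph) :
    ∃ e : (L × L) ≃ₗ[L] (L × L), ∀ u, u ∈ U ↔ e u ∈ (psi K L 5).graph := by
  obtain ⟨c, rfl | rfl⟩ := eq_smul_graph_of_linearSet_eq hn hq U hU
  · exact ⟨LinearEquiv.smulOfUnit c⁻¹, fun u => mem_units_smul_iff _ c u⟩
  · refine ⟨(LinearEquiv.smulOfUnit c⁻¹).trans (LinearEquiv.prodComm L L L), fun u => ?_⟩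
    rw [mem_units_smul_iff, ← swap_mem_graph_psi_iff hn (two_ne_zero_of_card hq)]
    rfl

theorem isSimple_psi (hn : Module.finrank K L = 10) (hq : Fintype.card K ≡ 1 [MOD 4]) :
    IsSimple K (linearSet (psi K L 5).graph) := by
  constructor
  · exact ⟨fun _ => (psi K L 5).graph, fun _ => rfl,
      fun i j hij => absurd (Subsingleton.elim i j) hij⟩
  · rintro m ⟨U, hU, hne⟩
    by_contra hm
    have hm : 1 < m := not_le.1 hm
    refine hne ⟨0, by omega⟩ ⟨1, hm⟩ (by simp) ?_
    obtain ⟨e, he⟩ := exists_linearEquiv_graph_psi hn hq _ (hU ⟨0, by omega⟩)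
    obtain ⟨e', he'⟩ := exists_linearEquiv_graph_psi hn hq _ (hU ⟨1, hm⟩)
    refine gammaLEquiv_of_linearEquiv (e.trans e'.symm) fun u => ?_
    rw [SetLike.mem_coe, SetLike.mem_coe, he, he']
    simp

theorem linPoly_eq_zero (hn : Module.finrank K L = 10) {γ : Fin 10 → L}
    (h : ∀ x, linPoly K γ x = 0) : γ = 0 := by
  apply linPoly_injective K hn
  ext x
  rw [h]
  simp [linPoly_apply]

omit [Finite L] in
theorem linPoly_single (i : Fin 10) (a x : L) :
    ∑ j : Fin 10, (Pi.single i a : Fin 10 → L) j * fr K (j : ℕ) x = a * fr K (i : ℕ) x := by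
  rw [Finset.sum_eq_single i] <;> simp +contextual

/-- Coefficients of x^q and x^(q^4) would give c^q = c and c^(q^4) = -c. -/
theorem graph_psi_ne_smul (hn : Module.finrank K L = 10) (h2 : (2 : L) ≠ 0) (c : Lˣ) :
    (psi K L 5).graph ≠ c • (psiAdj K L).graph := by
  intro h
  have hx : ∀ x, (c : L) * psiAdj K L x = psi K L 5 (c * x) := by
    intro x
    have : c • ((x, psiAdj K L x) : L × L) ∈ (psi K L 5).graph := by
      rw [h, mem_units_smul_iff, inv_smul_smul]
      simp [LinearMap.mem_graph_iff]
    exact (LinearMap.mem_graph_iff _ _).1 this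
  have key : ![0, fr K 1 (c : L) - c, 0, 0, fr K 4 (c : L) + c, 0, -(fr K 6 (c : L) + c), 0, 0,
      fr K 9 (c : L) - c] = 0 := by
    refine linPoly_eq_zero (K := K) hn fun x => ?_
    have h' := hx x
    rw [psi_apply, psiAdj_apply] at h'
    simp only [map_mul] at h'
    field_simp at h'
    rw [linPoly_apply]
    simp [Fin.sum_univ_succ]
    linear_combination -h'
  have k1 : fr K 1 (c : L) - c = 0 := congrFun key 1
  have k4 : fr K 4 (c : L) + c = 0 := congrFun key 4
  rw [fr_eq_self_of_fr_one (sub_eq_zero.1 k1)] at k4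
  have : 2 * (c : L) = 0 := by linear_combination k4
  simp [h2] at this

theorem hasZClass_psi (hn : Module.finrank K L = 10) (hq : Fintype.card K ≡ 1 [MOD 4]) :
    HasZClass K (linearSet (psi K L 5).graph) 2 := by
  have h2 : (2 : L) ≠ 0 := two_ne_zero_of_card hq
  constructor
  · refine ⟨![(psi K L 5).graph, (psiAdj K L).graph], ?_, ?_⟩
    · intro i
      fin_cases i
      · rfl
      · exact (linearSet_graph_eq_iff _ _).2 (directions_psiAdj hn)
    · intro i j hij c
      have h := graph_psi_ne_smul (K := K) hn h2
      fin_cases i <;> fin_cases j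
      · exact absurd rfl hij
      · exact h c
      · intro h'
        refine h c⁻¹ ?_
        change (psiAdj K L).graph = c • (psi K L 5).graph at h'
        rw [h', inv_smul_smul]
      · exact absurd rfl hij
  · rintro m ⟨U, hU, hne⟩
    by_contra hm
    have hm : 2 < m := not_le.1 hm
    choose c hc using fun i => eq_smul_graph_of_linearSet_eq hn hq (U i) (hU i)
    classical
    obtain ⟨i, j, hij, hd⟩ := Fintype.exists_ne_map_eq_of_card_lt
      (fun i : Fin m => decide (U i = c i • (psi K L 5).graph)) (by simpa using hm)
    have hsame : ∃ V : Submodule K (L × L), U i = c i • V ∧ U j = c j • V := by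
      by_cases hi : U i = c i • (psi K L 5).graph
      · exact ⟨_, hi, by simpa [hi] using hd⟩
      · have hj : ¬ U j = c j • (psi K L 5).graph := by simpa [hi] using hd
        exact ⟨_, (hc i).resolve_left hi, (hc j).resolve_left hj⟩
    obtain ⟨V, hi, hj⟩ := hsame
    refine hne i j hij (c i * (c j)⁻¹) ?_
    rw [hi, hj, mul_smul, inv_smul_smul]

end Orbits

/-! ### Inequivalence with the pseudoregulus and LP types. -/

section Newness

variable {K L : Type*} [Field K] [Fintype K] [Field L] [Algebra K L]

theorem ringEquiv_fr (σ : L ≃+* L) (i : ℕ) (x : L) : σ (fr K i x) = fr K i (σ x) := by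
  rw [fr_apply, fr_apply, map_pow]

theorem ringEquiv_psi (σ : L ≃+* L) (x : L) : σ (psi K L 5 x) = psi K L 5 (σ x) := by
  have h2 : σ 2 = 2 := map_ofNat σ 2
  simp only [psi_apply, map_mul, map_add, map_sub, map_inv₀, ringEquiv_fr, h2]

variable [Finite L]

theorem ringEquiv_algebraMap (σ : L ≃+* L) (k : K) :
    ∃ k' : K, algebraMap K L k' = σ (algebraMap K L k) := by
  rw [← fr_one_eq_self_iff, ← ringEquiv_fr, (fr_one_eq_self_iff K _).2 ⟨k, rfl⟩]

/-- A collineation between linear sets pulls back defining subspaces to defining subspaces. -/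
theorem exists_submodule_of_map_image_eq (σ : L ≃+* L) (g : (L × L) →ₛₗ[(σ : L →+* L)] (L × L))
    (hg : Function.Bijective g) {S : Set (ℙ L (L × L))} (W : Submodule K (L × L))
    (h : Projectivization.map g hg.injective '' S = linearSet W) :
    ∃ U : Submodule K (L × L), linearSet U = S ∧ ∀ u, u ∈ U ↔ g u ∈ W := by
  refine ⟨{ carrier := {u | g u ∈ W}, add_mem' := ?_, zero_mem' := ?_, smul_mem' := ?_ }, ?_, ?_⟩
  · intro u v hu hv
    change g (u + v) ∈ W
    rw [map_add]
    exact W.add_mem hu hv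
  · change g 0 ∈ W
    rw [map_zero]
    exact W.zero_mem
  · intro k u hu
    change g (k • u) ∈ W
    obtain ⟨k', hk'⟩ := ringEquiv_algebraMap (K := K) σ k
    rw [← algebraMap_smul L k u, map_smulₛₗ, RingEquiv.coe_toRingHom, ← hk', algebraMap_smul]
    exact W.smul_mem k' hu
  · have := RingHomInvPair.of_ringEquiv σ
    have hinj := Projectivization.map_injective (τ := (σ.symm : L →+* L)) g hg.injective
    ext P
    constructor
    · rintro ⟨u, hu0, hu, rfl⟩
      have hgu : g u ≠ 0 := fun h0 => hu0 (hg.injective (by rw [h0, map_zero]))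
      have hmem : Projectivization.mk L (g u) hgu ∈ linearSet W := ⟨g u, hgu, hu, rfl⟩
      rw [← h] at hmem
      obtain ⟨Q, hQ, hQu⟩ := hmem
      rw [← Projectivization.map_mk g hg.injective u hu0] at hQu
      rwa [← hinj hQu]
    · intro hP
      induction P using Projectivization.ind with
      | h v hv =>
        have hmem : Projectivization.map g hg.injective (Projectivization.mk L v hv) ∈
            linearSet W := h ▸ ⟨_, hP, rfl⟩
        obtain ⟨w, hw0, hw, hwv⟩ := hmem
        rw [Projectivization.map_mk, Projectivization.mk_eq_mk_iff'] at hwv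
        obtain ⟨a, ha⟩ := hwv
        obtain ⟨u, rfl⟩ := hg.surjective w
        have hu0 : u ≠ 0 := by rintro rfl; exact hw0 (map_zero g)
        refine ⟨u, hu0, hw, ?_⟩
        rw [Projectivization.mk_eq_mk_iff']
        refine ⟨σ.symm a, hg.injective ?_⟩
        rw [map_smulₛₗ, RingEquiv.coe_toRingHom, RingEquiv.apply_symm_apply, ha]
  · intro u
    rfl

/-- Pulling the graph of f back gives, by the classification, a multiple of the graph of ψ or of ψ*;
the latter is parametrized as (ψ(x), x). As σ commutes with ψ, it is absorbed into y = σ(x). The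
pair (a, c) is nonzero as a multiple of the image of a basis vector. -/
theorem exists_relation_of_pGammaLEquiv (hn : Module.finrank K L = 10)
    (hq : Fintype.card K ≡ 1 [MOD 4]) {f : L →ₗ[K] L}
    (h : PGammaLEquiv (linearSet (psi K L 5).graph) (linearSet f.graph)) :
    ∃ a b c d : L, (a ≠ 0 ∨ c ≠ 0) ∧
      ∀ y, f (a * y + b * psi K L 5 y) = c * y + d * psi K L 5 y := by
  obtain ⟨σ, g, hg, h⟩ := h
  obtain ⟨U, hU, hUg⟩ := exists_submodule_of_map_image_eq σ g hg _ h
  obtain ⟨e, he⟩ : ∃ e : Lˣ, (∀ x, g ((e : L) * x, e * psi K L 5 x) ∈ f.graph) ∨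
      (∀ x, g (e * psi K L 5 x, e * x) ∈ f.graph) := by
    obtain ⟨e, rfl | rfl⟩ := eq_smul_graph_of_linearSet_eq hn hq U hU
    · refine ⟨e, Or.inl fun x => ?_⟩
      rw [← hUg, mem_units_smul_iff, LinearMap.mem_graph_iff]
      simp [Units.smul_def]
    · refine ⟨e, Or.inr fun x => ?_⟩
      rw [← hUg, mem_units_smul_iff, LinearMap.mem_graph_iff]
      simp [Units.smul_def, psiAdj_psi hn (two_ne_zero_of_card hq)]
  have hgexp : ∀ u v : L, g (u, v) = σ u • g (1, 0) + σ v • g (0, 1) := by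
    intro u v
    have : ((u, v) : L × L) = u • (1, 0) + v • (0, 1) := by simp
    rw [this, map_add, map_smulₛₗ, map_smulₛₗ]
    rfl
  have hσe : σ (e : L) ≠ 0 := (map_ne_zero σ).2 e.ne_zero
  have hne : ∀ w : L × L, w ≠ 0 → σ (e : L) * (g w).1 ≠ 0 ∨ σ (e : L) * (g w).2 ≠ 0 := by
    intro w hw
    by_contra hcon
    simp only [not_or, not_not, mul_eq_zero, hσe, false_or] at hcon
    exact hw (hg.injective (by rw [map_zero]; exact Prod.ext hcon.1 hcon.2))
  rcases he with he | he
  · refine ⟨σ e * (g (1, 0)).1, σ e * (g (0, 1)).1, σ e * (g (1, 0)).2, σ e * (g (0, 1)).2,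
      hne _ (by simp), fun y => ?_⟩
    have := he (σ.symm y)
    rw [LinearMap.mem_graph_iff, hgexp] at this
    simp only [map_mul, ringEquiv_psi, RingEquiv.apply_symm_apply, Prod.fst_add, Prod.snd_add,
      Prod.smul_fst, Prod.smul_snd, smul_eq_mul] at this
    have e1 : σ e * (g (1, 0)).1 * y + σ e * (g (0, 1)).1 * psi K L 5 y = σ e * y * (g (1, 0)).1 +
        σ e * psi K L 5 y * (g (0, 1)).1 := by ring
    rw [e1, ← this]
    ring
  · refine ⟨σ e * (g (0, 1)).1, σ e * (g (1, 0)).1, σ e * (g (0, 1)).2, σ e * (g (1, 0)).2,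
      hne _ (by simp), fun y => ?_⟩
    have := he (σ.symm y)
    rw [LinearMap.mem_graph_iff, hgexp] at this
    simp only [map_mul, ringEquiv_psi, RingEquiv.apply_symm_apply, Prod.fst_add, Prod.snd_add,
      Prod.smul_fst, Prod.smul_snd, smul_eq_mul] at this
    have e1 : σ e * (g (0, 1)).1 * y + σ e * (g (1, 0)).1 * psi K L 5 y = σ e * psi K L 5 y * (g (1, 0)).1 +
        σ e * y * (g (0, 1)).1 := by ring
    rw [e1, ← this]
    ring

/-- The coefficients of the monomials of `(x ^ (q ^ s)) ∘ (a x + b ψ₁₀(x))`, up to a factor two. -/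
def compCoeff (s : Fin 10) (a b : L) : Fin 10 → L :=
  Pi.single s (2 * a) + Pi.single (s + 1) b + Pi.single (s + 4) b - Pi.single (s + 6) b +
    Pi.single (s + 9) b

theorem linPoly_compCoeff (hn : Module.finrank K L = 10) (h2 : (2 : L) ≠ 0) (s : Fin 10)
    (a b x : L) : linPoly K (compCoeff s (fr K s a) (fr K s b)) x =
      2 * fr K s (a * x + b * psi K L 5 x) := by
  have hval : ∀ j : Fin 10, fr K ((s + j : Fin 10) : ℕ) x = fr K s (fr K j x) := fun j => by
    rw [Fin.val_add, fr_mod K hn, fr_fr]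
  rw [linPoly_apply]
  simp only [compCoeff, Pi.add_apply, Pi.sub_apply, add_mul, sub_mul, Finset.sum_add_distrib,
    Finset.sum_sub_distrib, linPoly_single, hval]
  rw [psi_apply]
  simp only [map_mul, map_add, map_sub, map_inv₀, fr_two]
  have v1 : ((1 : Fin 10) : ℕ) = 1 := rfl
  have v4 : ((4 : Fin 10) : ℕ) = 4 := rfl
  have v6 : ((6 : Fin 10) : ℕ) = 6 := rfl
  have v9 : ((9 : Fin 10) : ℕ) = 9 := rfl
  rw [v1, v4, v6, v9]
  field_simp
  ring

/-- No linear set of pseudoregulus or LP type is equivalent to that of `ψ₁₀`. -/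
theorem not_pGammaLEquiv (hn : Module.finrank K L = 10) (hq : Fintype.card K ≡ 1 [MOD 4])
    (s t : Fin 10)
    (hs : s = 1 ∧ t = 9 ∨ s = 3 ∧ t = 7 ∨ s = 7 ∧ t = 3 ∨ s = 9 ∧ t = 1) (δ : L) {f : L →ₗ[K] L}
    (hf : ∀ x, f x = fr K (s : ℕ) x + δ * fr K (t : ℕ) x) :
    ¬ PGammaLEquiv (linearSet (psi K L 5).graph) (linearSet f.graph) := by
  intro h
  have h2 : (2 : L) ≠ 0 := two_ne_zero_of_card hq
  obtain ⟨a, b, c, d, hac, hrel⟩ := exists_relation_of_pGammaLEquiv hn hq h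
  have key : compCoeff s (fr K (s : ℕ) a) (fr K (s : ℕ) b) +
      δ • compCoeff t (fr K (t : ℕ) a) (fr K (t : ℕ) b) -
      compCoeff 0 c d = 0 := by
    refine linPoly_eq_zero (K := K) hn fun x => ?_
    have e1 := linPoly_compCoeff hn h2 s a b x
    have e2 := linPoly_compCoeff hn h2 t a b x
    have e3 := linPoly_compCoeff hn h2 0 c d x
    have h' := hrel x
    rw [hf] at h'
    simp only [Fin.val_zero, fr_zero] at e3
    rw [linPoly_apply] at e1 e2 e3 ⊢
    simp only [Pi.add_apply, Pi.sub_apply, Pi.smul_apply, smul_eq_mul, add_mul, sub_mul, mul_assoc,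
      Finset.sum_add_distrib, Finset.sum_sub_distrib, ← Finset.mul_sum]
    rw [e1, e2, e3]
    linear_combination 2 * h'
  -- At exponent 2 or 8, as chosen below, only the b-term of x^(q^s) contributes, whatever δ is.
  have hb : b = 0 := by
    have : ∀ i : ℕ, fr K i b = 0 → b = 0 := fun i => (map_eq_zero (fr K i)).1
    apply this s
    rcases hs with ⟨rfl, rfl⟩ | ⟨rfl, rfl⟩ | ⟨rfl, rfl⟩ | ⟨rfl, rfl⟩
    · simpa [compCoeff, Pi.single_apply] using congrFun key 2
    · simpa [compCoeff, Pi.single_apply] using congrFun key 2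
    · simpa [compCoeff, Pi.single_apply] using congrFun key 8
    · simpa [compCoeff, Pi.single_apply] using congrFun key 8
  subst hb
  have hd : d = 0 := by
    -- With b = 0 the left side lives at the odd exponents s and t, so exponent 4 isolates d.
    have := congrFun key 4
    rcases hs with ⟨rfl, rfl⟩ | ⟨rfl, rfl⟩ | ⟨rfl, rfl⟩ | ⟨rfl, rfl⟩ <;>
      simpa [compCoeff, Pi.single_apply] using this
  subst hd
  have ha : a = 0 := by
    have : ∀ i : ℕ, fr K i a = 0 → a = 0 := fun i => (map_eq_zero (fr K i)).1
    apply this s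
    have := congrFun key s
    rcases hs with ⟨rfl, rfl⟩ | ⟨rfl, rfl⟩ | ⟨rfl, rfl⟩ | ⟨rfl, rfl⟩ <;>
      simpa [compCoeff, Pi.single_apply, h2] using this
  have hc : c = 0 := by
    have := congrFun key 0
    rcases hs with ⟨rfl, rfl⟩ | ⟨rfl, rfl⟩ | ⟨rfl, rfl⟩ | ⟨rfl, rfl⟩ <;>
      simpa [compCoeff, Pi.single_apply, h2] using this
  exact hac.elim (fun h => h ha) (fun h => h hc)

theorem eq_of_coprime_ten {s : ℕ} (h1 : s < 10) (h2 : s.Coprime 10) :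
    s = 1 ∨ s = 3 ∨ s = 7 ∨ s = 9 := by
  interval_cases s <;> revert h2 <;> decide

end Newness

end LinSet

theorem proposition4p6 {K L : Type*} [Field K] [Fintype K] [Field L] [Algebra K L] (q : ℕ)
    (hcard : Fintype.card K = q) (hq : q ≡ 1 [MOD 4]) (hn : Module.finrank K L = 10) :
    LinSet.HasZClass K (LinSet.linearSet (LinSet.psi K L 5).graph) 2 ∧
    LinSet.IsSimple K (LinSet.linearSet (LinSet.psi K L 5).graph) ∧
    LinSet.IsMaximumScattered K (LinSet.linearSet (LinSet.psi K L 5).graph) ∧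
    (∀ S : Set (Projectivization L (L × L)), LinSet.IsPseudoregulusForm K L S →
      ¬ LinSet.PGammaLEquiv (LinSet.linearSet (LinSet.psi K L 5).graph) S) ∧
    (∀ S : Set (Projectivization L (L × L)), LinSet.IsLPForm K L S →
      ¬ LinSet.PGammaLEquiv (LinSet.linearSet (LinSet.psi K L 5).graph) S) := by
  subst hcard
  have : Module.Finite K L := Module.finite_of_finrank_pos (by rw [hn]; norm_num)
  have : Finite L := Module.finite_of_finite K
  refine ⟨LinSet.hasZClass_psi hn hq, LinSet.isSimple_psi hn hq,
    LinSet.isMaximumScattered_graph (LinSet.scatteredMap_psi hn hq), ?_, ?_⟩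
  · rintro S ⟨s, -, hs, hcop, rfl⟩
    rw [hn] at hs hcop
    obtain rfl | rfl | rfl | rfl := LinSet.eq_of_coprime_ten hs hcop
    · exact LinSet.not_pGammaLEquiv hn hq 1 9 (by decide) 0 fun x => by simp [LinSet.frob_eq_fr]
    · exact LinSet.not_pGammaLEquiv hn hq 3 7 (by decide) 0 fun x => by simp [LinSet.frob_eq_fr]
    · exact LinSet.not_pGammaLEquiv hn hq 7 3 (by decide) 0 fun x => by simp [LinSet.frob_eq_fr]
    · exact LinSet.not_pGammaLEquiv hn hq 9 1 (by decide) 0 fun x => by simp [LinSet.frob_eq_fr]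
  · rintro S ⟨s, δ, -, hs, hcop, -, -, rfl⟩
    rw [hn] at hs hcop ⊢
    obtain rfl | rfl | rfl | rfl := LinSet.eq_of_coprime_ten hs hcop
    -- The monomial with coefficient 1 is x^(q^(10-s)), so 10 - s takes the first place.
    · exact LinSet.not_pGammaLEquiv hn hq 9 1 (by decide) δ fun x => add_comm _ _
    · exact LinSet.not_pGammaLEquiv hn hq 7 3 (by decide) δ fun x => add_comm _ _
    · exact LinSet.not_pGammaLEquiv hn hq 3 7 (by decide) δ fun x => add_comm _ _
    · exact LinSet.not_pGammaLEquiv hn hq 1 9 (by decide) δ fun x => add_comm _ _
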